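/- **Model.** Requests of classes $i=1,\dots,m$ arrive at a resource of capacity $b>0$ in independent Poisson streams of rates $\lambda_i>0$. A class $i$ request needs $b_i>0$ units of capacity, has an exponential service time of rate $\mu_i>0$, and pays $r_i\ge 0$ per unit time while in service; put $\rho_i=\lambda_i/\mu_i$. An arriving request is either admitted to the resource (system 0) or rejected; a rejected request is sent to a fictitious system 1 of infinite capacity, where it stays for an independent exponential time of rate $\mu_i$. Let $\bar x_i(t)$ and $\bar y_i(t)$ be the numbers of class $i$ requests in systems 0 and 1 at time $t$. **Parameters.** Let $0<\varepsilon<\frac14$ and let $\alpha^\varepsilon$ be an optimal solution of the linear program $$\text{maximize } \sum_{i=1}^m r_i\rho_i\alpha_i\quad\text{subject to}\quad \sum_{i=1}^m b_i\rho_i\alpha_i\le \frac{b}{1+4\varepsilon},\qquad 0\le\alpha_i\le1,\quad i=1,\dots,m.$$ Put $c_i^0=(1+4\varepsilon)\alpha_i^\varepsilon b_i\rho_i$ and $c_i^1=(1+4\varepsilon)(1-\alpha_i^\varepsilon)b_i\rho_i$, and let $$0<\beta\le\varepsilon\min\Big\{\min_{1\le i\le m}\frac{c_i^0}{b_i},\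 \min_{i:\,\alpha_i^\varepsilon<1}\frac{c_i^1}{b_i}\Big\}.$$ **Exponential penalty policy $\bar\pi$.** With $\Psi_i(x,y)=\exp(\beta b_ix/c_i^0)+\exp(\beta b_iy/c_i^1)$, a class $i$ request arriving in the state $(x,y)$ is admitted if and only if $$\frac{\partial\Psi_i}{\partial x}(x_i,y_i)\le\frac{\partial\Psi_i}{\partial y}(x_i,y_i)\qquad\text{and}\qquad \sum_{j=1}^m b_jx_j+b_i\le b,$$ where the first condition is regarded as satisfied when $c_i^1=0$ (that is, when $\alpha_i^\varepsilon=1$). Thus $(\bar x,\bar y)$ is the continuous-time Markov chain on $\mathbf Z_+^{2m}$ in which a class $i$ arrival occurs at rate $\lambda_i$ and increases $x_i$ by 1 if it is admitted and $y_i$ by 1 otherwise, while $x_i$ and $y_i$ decrease by 1 at rates $\mu_ix_i$ and $\mu_iy_i$. **Theorem.** Suppose that the numbers $(1-\alpha_i^\varepsilon)\rho_i$ are integers and that the system starts from $\bar x_i(0^-)=0$, $\bar y_i(0^-)=(1-\alpha_i^\varepsilon)\rho_i$ for $i=1,\dots,m$. Then the reward rate $\bar R(t)=\sum_{i=1}^m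 r_i\bar x_i(t)$ is integrable and satisfies, for all $t\ge0$, $$\mathbf E[\bar R(t)]\ \ge\ \max\Big\{\sum_{i=1}^m\alpha_i^\varepsilon r_i\rho_i(1-e^{-\mu_it})-\zeta\sum_{i=1}^m(1-\alpha_i^\varepsilon)r_i\rho_i-2e^{-\frac{\varepsilon}{2}(\beta-4)}\sum_{i=1}^m r_i\rho_i(1-e^{-\mu_it}),\ 0\Big\},$$ where $$\zeta=\Big(\frac{\log 2}{\beta}+1-\frac{\varepsilon}{2}\Big)(1+4\varepsilon)-1.$$ -/

import Mathlib

open MeasureTheory ProbabilityTheory Filter Topology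
open scoped NNReal

namespace LossNetwork

/-- Single-resource loss model with `m` request classes: class `i` requests arrive in a Poisson
stream of rate `lam i`, have exponential service times of rate `mu i`, occupy `req i` units of
capacity while in service and pay `r i` per unit time. The resource has capacity `cap`. -/
structure Model (m : ℕ) where
  lam : Fin m → ℝ
  mu : Fin m → ℝ
  req : Fin m → ℝ
  r : Fin m → ℝ
  cap : ℝ
  lam_pos : ∀ i, 0 < lam i
  mu_pos : ∀ i, 0 < mu i
  req_pos : ∀ i, 0 < req i
  r_nonneg : ∀ i, 0 ≤ r i
  cap_pos : 0 < cap

/-- A state `(x, y)`: `x i` (resp. `y i`) is the number of class `i` requests in service in the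
original system 0 (resp. in the fictitious infinite capacity system 1). -/
abbrev State (m : ℕ) : Type := (Fin m → ℕ) × (Fin m → ℕ)

namespace Model

variable {m : ℕ} (M : Model m)

/-- The load `ρ_i = λ_i / μ_i`. -/
noncomputable def rho (i : Fin m) : ℝ := M.lam i / M.mu i

/-- Feasibility for the `ε`-perturbed steady-state linear program. -/
def PerturbedFeasible (ε : ℝ) (α : Fin m → ℝ) : Prop :=
  ∑ i, M.req i * M.rho i * α i ≤ M.cap / (1 + 4 * ε) ∧ ∀ i, 0 ≤ α i ∧ α i ≤ 1

/-- `α` is an optimal solution of the `ε`-perturbed steady-state linear program. -/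
def PerturbedOptimal (ε : ℝ) (α : Fin m → ℝ) : Prop :=
  M.PerturbedFeasible ε α ∧
    ∀ α' : Fin m → ℝ, M.PerturbedFeasible ε α' →
      ∑ i, M.r i * M.rho i * α' i ≤ ∑ i, M.r i * M.rho i * α i

/-- The target capacities `c_i^0 = (1 + 4 ε) α_i b_i ρ_i` of system 0. -/
noncomputable def c0 (ε : ℝ) (α : Fin m → ℝ) (i : Fin m) : ℝ :=
  (1 + 4 * ε) * α i * M.req i * M.rho i

/-- The target capacities `c_i^1 = (1 + 4 ε) (1 - α_i) b_i ρ_i` of system 1. -/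
noncomputable def c1 (ε : ℝ) (α : Fin m → ℝ) (i : Fin m) : ℝ :=
  (1 + 4 * ε) * (1 - α i) * M.req i * M.rho i

/-- The upper bound on `β`:
`β ≤ ε * min (min_i (c_i^0 / b_i)) (min_{i : α_i < 1} (c_i^1 / b_i))`. -/
def BetaBound (ε β : ℝ) (α : Fin m → ℝ) : Prop :=
  (∀ i, β ≤ ε * (M.c0 ε α i / M.req i)) ∧
    ∀ i, α i < 1 → β ≤ ε * (M.c1 ε α i / M.req i)

/-- The class `i` penalty `Ψ_i(x, y) = exp (β b_i x / c_i^0) + exp (β b_i y / c_i^1)`. -/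
noncomputable def penalty (β : ℝ) (c₀ c₁ : Fin m → ℝ) (i : Fin m) (x y : ℝ) : ℝ :=
  Real.exp (β * (M.req i * x / c₀ i)) + Real.exp (β * (M.req i * y / c₁ i))

/-- The penalty test `∂Ψ_i/∂x_i ≤ ∂Ψ_i/∂y_i` at the state `s`. If `c_i^1 = 0`, the right-hand side
is `+∞` (its limit as `c_i^1` decreases to `0`), so that the test is passed. -/
def PenaltyAccepts (β : ℝ) (c₀ c₁ : Fin m → ℝ) (i : Fin m) (s : State m) : Prop :=
  c₁ i = 0 ∨
    deriv (fun u : ℝ => M.penalty β c₀ c₁ i u (s.2 i)) (s.1 i) ≤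
      deriv (fun v : ℝ => M.penalty β c₀ c₁ i (s.1 i) v) (s.2 i)

/-- There is room in system 0 for one more class `i` request. -/
def HasRoom (i : Fin m) (s : State m) : Prop :=
  ∑ j, M.req j * (s.1 j : ℝ) + M.req i ≤ M.cap

open Classical in
/-- The state after a class `i` arrival under the penalty policy: the request joins system 0 if it
passes the penalty test and fits; otherwise it is rejected and joins system 1. -/
noncomputable def afterArrival (β : ℝ) (c₀ c₁ : Fin m → ℝ) (i : Fin m) (s : State m) : State m :=
  if M.PenaltyAccepts β c₀ c₁ i s ∧ M.HasRoom i s then (s.1 + Pi.single i 1, s.2)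
  else (s.1, s.2 + Pi.single i 1)

/-- The generator of the state process under the penalty policy: class `i` requests arrive at
rate `λ_i`, and each class `i` request present in either system leaves at rate `μ_i`. (When
`s.1 i = 0` or `s.2 i = 0`, the corresponding departure term is multiplied by `0`.) -/
noncomputable def generator (β : ℝ) (c₀ c₁ : Fin m → ℝ) (f : State m → ℝ) (s : State m) : ℝ :=
  ∑ i, (M.lam i * (f (M.afterArrival β c₀ c₁ i s) - f s)
    + M.mu i * (s.1 i : ℝ) * (f (s.1 - Pi.single i 1, s.2) - f s)
    + M.mu i * (s.2 i : ℝ) * (f (s.1, s.2 - Pi.single i 1) - f s))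

/-- The instantaneous reward rate `R = ∑ r_i x_i` in the state `s`. -/
noncomputable def rewardRate (s : State m) : ℝ := ∑ i, M.r i * (s.1 i : ℝ)

end Model

/-- `X` is a continuous-time Markov chain on the discrete countable space `State m`, with generator
`A` and initial state `s₀`, with respect to the filtration `ℱ`: it is adapted, its paths are right
continuous with left limits (hence it does not explode), and it solves the martingale problem for
`A` on the functions with finite support. -/
structure IsMarkovChain {m : ℕ} (A : (State m → ℝ) → State m → ℝ) (s₀ : State m)
    {Ω : Type*} {mΩ : MeasurableSpace Ω} (P : Measure Ω) (ℱ : Filtration ℝ≥0 mΩ)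
    (X : ℝ≥0 → Ω → State m) : Prop where
  measurable : ∀ t, Measurable[ℱ t] (X t)
  right_cont : ∀ ω t, ContinuousWithinAt (fun u => X u ω) (Set.Ici t) t
  left_lim : ∀ ω t, ∃ l, Tendsto (fun u => X u ω) (𝓝[<] t) (𝓝 l)
  initial : ∀ᵐ ω ∂P, X 0 ω = s₀
  martingale : ∀ f : State m → ℝ, f.support.Finite →
    Martingale (fun (t : ℝ≥0) ω => f (X t ω) - ∫ u in (0 : ℝ)..t, A f (X u.toNNReal ω)) ℱ P

end LossNetwork

/-! Each class is controlled by a Lyapunov function of its own two counts `(x, y)`. Suppose first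
that `β ≥ 4` and that there is always room. Sending an arrival where the marginal penalty is smaller
is no worse than splitting arrivals in the proportions `α_i : 1 - α_i`, under which each system
carries its target load. The factor `1 + 4ε` absorbs the second-order errors, so the penalty `G` has
drift at most `μ_i (W - G)` with `W = 2 exp (β (1 - ε/2))` (`drift_expPair_le`).

A full resource spoils this, since a request that passes the test may be forced into system 1. The
remedy is `shiftMin c G`, the infimum of `G` over configurations in which some requests of system 1
are counted in system 0 at price `c` each. A forced rejection can then be undone on paper for `c`,
so the drift bound survives up to the error `λ_i c` while there is no room (`drift_shiftMin_le`).

This is used twice. With `c = 0` the error vanishes, which bounds the exponential moments of the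
counts in system 0 (`integral_exp_le`); Jensen and Markov then bound the probability of a full
resource (`integral_noRoom_le`). With `c = d W`, where `d = β b_i / c_i^1`, the shifted minimum
dominates an affine function of `y` of slope `c`; since `x + y` has drift `μ_i (ρ_i - (x + y))`, an
upper bound on the mean of `y` gives a lower bound on that of `x` (`integral_fst_ge_of_lt_one`).
Classes with `α_i = 1` are compared directly with an infinite-server queue, and for `β < 4` the
claimed lower bound for each class is at most 0.

The martingale problem is posed only for finitely supported functions. Domination of the population
by a Poisson variable extends Dynkin's formula to functions of exponential growth
(`integral_eq_add_integral_generator`). -/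

namespace LossNetwork

variable {m : ℕ}

/-! ### Population size and growth bounds for the generator. -/

/-- The total number of requests present in the two systems. -/
def population (s : State m) : ℕ := ∑ i, (s.1 i + s.2 i)

lemma le_population (s : State m) (i : Fin m) : s.1 i + s.2 i ≤ population s :=
  Finset.single_le_sum (f := fun j => s.1 j + s.2 j) (fun _ _ => Nat.zero_le _) (Finset.mem_univ i)

lemma finite_population_lt (n : ℕ) : {s : State m | population s < n}.Finite := by
  have h : (Set.Icc (0 : Fin m → ℕ) fun _ => n).Finite := Set.finite_Icc _ _
  refine (h.prod h).subset fun s hs => ?_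
  have hs' : population s < n := hs
  refine ⟨⟨fun i => Nat.zero_le _, fun i => ?_⟩, ⟨fun i => Nat.zero_le _, fun i => ?_⟩⟩ <;>
  · have := le_population s i
    show _ ≤ n
    omega

lemma population_add_fst (s : State m) (i : Fin m) :
    population (s.1 + Pi.single i 1, s.2) = population s + 1 := by
  simp [population, Finset.sum_add_distrib]
  omega

lemma population_add_snd (s : State m) (i : Fin m) :
    population (s.1, s.2 + Pi.single i 1) = population s + 1 := by
  simp [population, Finset.sum_add_distrib]
  omega

lemma population_sub_fst_le (s : State m) (i : Fin m) :
    population (s.1 - Pi.single i 1, s.2) ≤ population s :=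
  Finset.sum_le_sum fun j _ => by simp

lemma population_sub_snd_le (s : State m) (i : Fin m) :
    population (s.1, s.2 - Pi.single i 1) ≤ population s :=
  Finset.sum_le_sum fun j _ => by simp

lemma le_population_sub_fst (s : State m) (i : Fin m) :
    population s ≤ population (s.1 - Pi.single i 1, s.2) + 1 := by
  rw [← population_add_fst _ i]
  refine Finset.sum_le_sum fun j _ => ?_
  simp only [Pi.add_apply, Pi.sub_apply]
  omega

lemma le_population_sub_snd (s : State m) (i : Fin m) :
    population s ≤ population (s.1, s.2 - Pi.single i 1) + 1 := by
  rw [← population_add_snd _ i]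
  refine Finset.sum_le_sum fun j _ => ?_
  simp only [Pi.add_apply, Pi.sub_apply]
  omega

namespace Model

variable (M : Model m) (β : ℝ) (c₀ c₁ : Fin m → ℝ)

lemma population_afterArrival (i : Fin m) (s : State m) :
    population (M.afterArrival β c₀ c₁ i s) = population s + 1 := by
  unfold afterArrival
  split_ifs
  · exact population_add_fst s i
  · exact population_add_snd s i

/-- One transition raises the population by at most one, and the departure rates, linear in the
population, are absorbed by doubling the base. Exponential growth is thus preserved by the
generator. -/
lemma abs_generator_le {f : State m → ℝ} {C K : ℝ} (hC : 0 ≤ C) (hK : 1 ≤ K)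
    (hf : ∀ s, |f s| ≤ C * K ^ population s) (s : State m) :
    |M.generator β c₀ c₁ f s| ≤
      (C * (∑ i, (2 * M.lam i + 4 * M.mu i)) * (2 * K)) * (2 * K) ^ population s := by
  set Z := population s with hZ
  have hK0 : 0 < K := by linarith
  set Q := C * K ^ (Z + 1) with hQ
  have hQ0 : 0 ≤ Q := by positivity
  have hle : ∀ s', population s' ≤ Z + 1 → |f s'| ≤ Q := fun s' h =>
    (hf s').trans (mul_le_mul_of_nonneg_left (pow_le_pow_right₀ hK h) hC)
  have hdiff : ∀ s', population s' ≤ Z + 1 → |f s' - f s| ≤ 2 * Q := fun s' h => by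
    have h1 := hle s' h
    have h2 := hle s (Nat.le_succ _)
    have := abs_sub (f s') (f s)
    linarith
  have hZ2 : (Z : ℝ) ≤ 2 ^ (Z + 1) := by
    have : Z ≤ 2 ^ (Z + 1) :=
      Nat.lt_two_pow_self.le.trans (Nat.pow_le_pow_right (by norm_num) (by omega))
    exact_mod_cast this
  have h1 : (1 : ℝ) ≤ 2 ^ (Z + 1) := one_le_pow₀ (by norm_num)
  have hterm : ∀ i, |M.lam i * (f (M.afterArrival β c₀ c₁ i s) - f s)
      + M.mu i * (s.1 i : ℝ) * (f (s.1 - Pi.single i 1, s.2) - f s)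
      + M.mu i * (s.2 i : ℝ) * (f (s.1, s.2 - Pi.single i 1) - f s)|
      ≤ (2 * M.lam i + 4 * M.mu i) * (2 ^ (Z + 1) * Q) := by
    intro i
    have hl := (M.lam_pos i).le
    have hm := (M.mu_pos i).le
    have hx : (s.1 i : ℝ) ≤ 2 ^ (Z + 1) :=
      le_trans (by exact_mod_cast (Nat.le_add_right _ _).trans (le_population s i)) hZ2
    have hy : (s.2 i : ℝ) ≤ 2 ^ (Z + 1) :=
      le_trans (by exact_mod_cast (Nat.le_add_left _ _).trans (le_population s i)) hZ2
    have a1 : |M.lam i * (f (M.afterArrival β c₀ c₁ i s) - f s)| ≤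
        M.lam i * (2 ^ (Z + 1) * (2 * Q)) := by
      rw [abs_mul, abs_of_nonneg hl]
      refine mul_le_mul_of_nonneg_left ?_ hl
      have := hdiff _ (M.population_afterArrival β c₀ c₁ i s).le
      nlinarith
    have a2 : |M.mu i * (s.1 i : ℝ) * (f (s.1 - Pi.single i 1, s.2) - f s)| ≤
        M.mu i * (2 ^ (Z + 1) * (2 * Q)) := by
      rw [abs_mul, abs_mul, abs_of_nonneg hm, Nat.abs_cast, mul_assoc]
      gcongr
      exact hdiff _ ((population_sub_fst_le s i).trans (Nat.le_succ _))
    have a3 : |M.mu i * (s.2 i : ℝ) * (f (s.1, s.2 - Pi.single i 1) - f s)| ≤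
        M.mu i * (2 ^ (Z + 1) * (2 * Q)) := by
      rw [abs_mul, abs_mul, abs_of_nonneg hm, Nat.abs_cast, mul_assoc]
      gcongr
      exact hdiff _ ((population_sub_snd_le s i).trans (Nat.le_succ _))
    refine (abs_add_three _ _ _).trans ?_
    linarith
  calc |M.generator β c₀ c₁ f s| ≤ ∑ i, (2 * M.lam i + 4 * M.mu i) * (2 ^ (Z + 1) * Q) :=
        (Finset.abs_sum_le_sum_abs _ _).trans (Finset.sum_le_sum fun i _ => hterm i)
    _ = _ := by rw [← Finset.sum_mul, hQ, mul_pow]; ring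

lemma generator_eq_zero {f : State m → ℝ} {n : ℕ} (hf : ∀ s, n ≤ population s → f s = 0)
    {s : State m} (hs : n + 1 ≤ population s) : M.generator β c₀ c₁ f s = 0 := by
  refine Finset.sum_eq_zero fun i _ => ?_
  have h1 := M.population_afterArrival β c₀ c₁ i s
  have h2 := le_population_sub_fst s i
  have h3 := le_population_sub_snd s i
  rw [hf s (by omega), hf _ (by omega : n ≤ population (M.afterArrival β c₀ c₁ i s)),
    hf _ (by omega : n ≤ population (s.1 - Pi.single i 1, s.2)),
    hf _ (by omega : n ≤ population (s.1, s.2 - Pi.single i 1))]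
  ring

lemma exists_abs_generator_le {f : State m → ℝ} (hf : f.support.Finite) :
    ∃ C, ∀ s, |M.generator β c₀ c₁ f s| ≤ C := by
  obtain ⟨n, hn⟩ : ∃ n, ∀ s, n ≤ population s → f s = 0 := by
    obtain ⟨n, hn⟩ := (hf.image population).bddAbove
    refine ⟨n + 1, fun s hs => ?_⟩
    by_contra h
    have := hn ⟨s, h, rfl⟩
    omega
  have hfin : (M.generator β c₀ c₁ f).support.Finite := by
    refine (finite_population_lt (n + 1)).subset fun s hs => ?_
    by_contra h
    exact hs (M.generator_eq_zero β c₀ c₁ hn (not_lt.1 h))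
  obtain ⟨C, hC⟩ := (hfin.image fun s => |M.generator β c₀ c₁ f s|).bddAbove
  refine ⟨max C 0, fun s => ?_⟩
  by_cases h : M.generator β c₀ c₁ f s = 0
  · simp [h]
  · exact (hC ⟨s, h, rfl⟩).trans (le_max_left _ _)

/-- The arrival rate bounds the rate at which the population exceeds a given level. -/
lemma le_generator_indicator (n : ℕ) (s : State m) :
    -((∑ i, M.lam i) * {s : State m | n ≤ population s}.indicator 1 s) ≤
      M.generator β c₀ c₁ ({s : State m | population s < n + 1}.indicator 1) s := by
  rw [Finset.sum_mul, ← Finset.sum_neg_distrib]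
  refine Finset.sum_le_sum fun i _ => ?_
  have hl := (M.lam_pos i).le
  have hm := (M.mu_pos i).le
  have h1 := M.population_afterArrival β c₀ c₁ i s
  have h2 := population_sub_fst_le s i
  have h3 := population_sub_snd_le s i
  have hmono : ∀ s', population s' ≤ population s →
      0 ≤ ({s : State m | population s < n + 1}.indicator 1 s' : ℝ)
        - {s : State m | population s < n + 1}.indicator 1 s := fun s' h => by
    simp only [Set.indicator_apply, Set.mem_ofPred_eq, Pi.one_apply]
    split_ifs <;> first | omega | norm_num
  have h4 : -({s : State m | n ≤ population s}.indicator 1 s : ℝ) ≤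
      ({s : State m | population s < n + 1}.indicator 1 (M.afterArrival β c₀ c₁ i s) : ℝ)
        - {s : State m | population s < n + 1}.indicator 1 s := by
    simp only [Set.indicator_apply, Set.mem_ofPred_eq, Pi.one_apply, h1]
    split_ifs <;> first | omega | norm_num
  have a1 := mul_le_mul_of_nonneg_left h4 hl
  have a2 := mul_nonneg (mul_nonneg hm (Nat.cast_nonneg (s.1 i))) (hmono _ h2)
  have a3 := mul_nonneg (mul_nonneg hm (Nat.cast_nonneg (s.2 i))) (hmono _ h3)
  linarith

end Model

/-! ### Joint measurability and Dynkin's formula for finitely supported functions. -/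

namespace IsMarkovChain

variable {A : (State m → ℝ) → State m → ℝ} {s₀ : State m} {Ω : Type*} {mΩ : MeasurableSpace Ω}
  {P : Measure Ω} {ℱ : Filtration ℝ≥0 mΩ} {X : ℝ≥0 → Ω → State m}

lemma measurable_comp (hX : IsMarkovChain A s₀ P ℱ X) (g : State m → ℝ) (t : ℝ≥0) :
    Measurable fun ω => g (X t ω) :=
  (measurable_of_countable g).comp ((hX.measurable t).mono (ℱ.le t) le_rfl)

lemma measurable_uncurry (hX : IsMarkovChain A s₀ P ℱ X) (g : State m → ℝ) :
    Measurable fun p : ℝ × Ω => g (X p.1.toNNReal p.2) := by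
  have key : ∀ (e : ℕ → ℝ≥0) (u : ℝ≥0) (ω : Ω), Tendsto e atTop (𝓝[≥] u) →
      Tendsto (fun n => g (X (e n) ω)) atTop (𝓝 (g (X u ω))) := by
    intro e u ω he
    have hc : Continuous g := continuous_of_discreteTopology
    have hr : Tendsto (fun v => X v ω) (𝓝[≥] u) (𝓝 (X u ω)) := hX.right_cont ω u
    exact (hc.tendsto (X u ω)).comp (hr.comp he)
  have hstep : ∀ (e : ℕ → ℝ≥0) (N : ℝ → ℕ), Measurable N →
      Measurable fun p : ℝ × Ω => g (X (e (N p.1)) p.2) := by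
    intro e N hN
    have h1 : Measurable fun q : ℕ × Ω => g (X (e q.1) q.2) :=
      measurable_from_prod_countable_right fun k => hX.measurable_comp g (e k)
    exact h1.comp ((hN.comp measurable_fst).prodMk measurable_snd)
  -- The right end of the grid cell containing `u`: it takes countably many values, and it tends to
  -- `u` from the right, where the paths are continuous.
  let d : ℕ → ℝ≥0 → ℝ≥0 := fun n u => ((⌊u * (n + 1)⌋₊ : ℝ≥0) + 1) / (n + 1)
  have hd : ∀ u, Tendsto (fun n => d n u) atTop (𝓝[≥] u) := by
    intro u
    have hpos : ∀ n : ℕ, (0 : ℝ≥0) < n + 1 := fun n => by positivity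
    have hlow : ∀ n, u ≤ d n u := fun n => by
      rw [le_div_iff₀ (hpos n)]
      exact (Nat.lt_floor_add_one _).le
    have hupp : ∀ n, d n u ≤ u + 1 / (n + 1) := fun n => by
      rw [div_le_iff₀ (hpos n), add_mul, one_div, inv_mul_cancel₀ (hpos n).ne']
      gcongr
      exact Nat.floor_le zero_le
    refine tendsto_nhdsWithin_iff.2 ⟨?_, Eventually.of_forall hlow⟩
    refine tendsto_of_tendsto_of_tendsto_of_le_of_le tendsto_const_nhds ?_ hlow hupp
    have := (tendsto_const_nhds (x := u) (f := atTop)).add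
      (tendsto_one_div_add_atTop_nhds_zero_nat (𝕜 := ℝ≥0))
    simpa using this
  refine measurable_of_tendsto_metrizable (f := fun (n : ℕ) (p : ℝ × Ω) =>
    g (X (d n p.1.toNNReal) p.2)) (fun n => ?_) (tendsto_pi_nhds.2 fun p => ?_)
  · exact hstep (fun k => ((k : ℝ≥0) + 1) / (n + 1)) (fun u => ⌊u.toNNReal * (n + 1)⌋₊)
      (Nat.measurable_floor.comp (measurable_real_toNNReal.mul_const _))
  · exact key _ _ _ (hd _)

end IsMarkovChain

namespace IsMarkovChain

section Bounded

variable {A : (State m → ℝ) → State m → ℝ} {s₀ : State m} {Ω : Type*}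
  {mΩ : MeasurableSpace Ω} {P : Measure Ω} [IsProbabilityMeasure P] {ℱ : Filtration ℝ≥0 mΩ}
  {X : ℝ≥0 → Ω → State m}

lemma stronglyMeasurable_integral (hX : IsMarkovChain A s₀ P ℱ X) (g : State m → ℝ) :
    StronglyMeasurable fun u : ℝ => ∫ ω, g (X u.toNNReal ω) ∂P :=
  (hX.measurable_uncurry g).stronglyMeasurable.integral_prod_right

lemma integrable_uncurry (hX : IsMarkovChain A s₀ P ℱ X) {g : State m → ℝ} {C : ℝ}
    (hg : ∀ s, |g s| ≤ C) (a b : ℝ) :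
    Integrable (Function.uncurry fun (u : ℝ) ω => g (X u.toNNReal ω))
      ((volume.restrict (Set.uIoc a b)).prod P) := by
  have : IsFiniteMeasure (volume.restrict (Set.uIoc a b)) := by
    rw [Set.uIoc]; infer_instance
  exact Integrable.of_bound (hX.measurable_uncurry g).aestronglyMeasurable C
    (Eventually.of_forall fun p => hg _)

/-- Dynkin's formula for functions with finite support. -/
lemma integral_eq_of_finite_support (hX : IsMarkovChain A s₀ P ℱ X) {f : State m → ℝ}
    (hf : f.support.Finite) (hA : ∃ C, ∀ s, |A f s| ≤ C) (t : ℝ≥0) :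
    ∫ ω, f (X t ω) ∂P = f s₀ + ∫ u in (0 : ℝ)..t, ∫ ω, A f (X u.toNNReal ω) ∂P := by
  obtain ⟨C, hC⟩ := hA
  obtain ⟨D, hD⟩ : ∃ D, ∀ s, |f s| ≤ D := by
    obtain ⟨D, hD⟩ := (hf.image fun s => |f s|).bddAbove
    refine ⟨max D 0, fun s => ?_⟩
    by_cases h : f s = 0
    · simp [h]
    · exact (hD ⟨s, h, rfl⟩).trans (le_max_left _ _)
  have hint := hX.integrable_uncurry hC 0 t
  have hint' : Integrable (fun ω => ∫ u in (0 : ℝ)..t, A f (X u.toNNReal ω)) P := by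
    have := hint.integral_prod_right
    simpa only [intervalIntegral.integral_of_le (NNReal.coe_nonneg t),
      Set.uIoc_of_le (NNReal.coe_nonneg t), Function.uncurry_apply_pair] using this
  have hf' : Integrable (fun ω => f (X t ω)) P :=
    Integrable.of_bound (hX.measurable_comp f t).aestronglyMeasurable D
      (Eventually.of_forall fun p => hD _)
  have h := (hX.martingale f hf).setIntegral_eq (zero_le (a := t)) MeasurableSet.univ
  simp only [setIntegral_univ, NNReal.coe_zero, intervalIntegral.integral_same, sub_zero] at h
  rw [integral_sub hf' hint', ← intervalIntegral_integral_swap hint] at h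
  have h0 : ∫ ω, f (X 0 ω) ∂P = f s₀ := by
    rw [integral_congr_ae (hX.initial.mono fun ω hω => by rw [hω] : _ =ᵐ[P] fun _ => f s₀)]
    simp
  linarith

end Bounded

/-! ### Poisson domination and exponential moments of the population. -/

variable {M : Model m} {β : ℝ} {c₀ c₁ : Fin m → ℝ} {s₀ : State m} {Ω : Type*}
  {mΩ : MeasurableSpace Ω} {P : Measure Ω} [IsProbabilityMeasure P] {ℱ : Filtration ℝ≥0 mΩ}
  {X : ℝ≥0 → Ω → State m}

/-- The population is dominated by a Poisson variable. -/
lemma measureReal_population_ge_le (hX : IsMarkovChain (M.generator β c₀ c₁) s₀ P ℱ X) (k : ℕ)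
    (t : ℝ≥0) :
    P.real {ω | population s₀ + k ≤ population (X t ω)} ≤ ((∑ i, M.lam i) * t) ^ k / k.factorial := by
  have hΛ : 0 ≤ ∑ i, M.lam i := Finset.sum_nonneg fun i _ => (M.lam_pos i).le
  induction k generalizing t with
  | zero => simp [measureReal_le_one]
  | succ k ih =>
    set n := population s₀ + k with hn
    set Λ := ∑ i, M.lam i with hΛdef
    -- The indicator of the complement of the event, since it is this one that has finite support.
    -- Its mean decreases at rate at most `Λ` times the probability of the previous level, so
    -- integrating the inductive bound in time yields the next one.
    set f : State m → ℝ := {s : State m | population s < n + 1}.indicator 1 with hf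
    have hfin : f.support.Finite :=
      (finite_population_lt (n + 1)).subset Set.support_indicator_subset
    have hbd := M.exists_abs_generator_le β c₀ c₁ hfin
    have hD := hX.integral_eq_of_finite_support hfin hbd t
    have hs₀ : f s₀ = 1 := by
      rw [hf, Set.indicator_of_mem (by show population s₀ < n + 1; omega)]; rfl
    have hmeas : ∀ (S : Set (State m)) (u : ℝ≥0), MeasurableSet {ω | X u ω ∈ S} := fun S u =>
      ((hX.measurable u).mono (ℱ.le u) le_rfl) S.to_countable.measurableSet
    have hind : ∀ (S : Set (State m)) (u : ℝ≥0),
        ∫ ω, S.indicator (1 : State m → ℝ) (X u ω) ∂P = P.real {ω | X u ω ∈ S} := fun S u => by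
      rw [← integral_indicator_one (hmeas S u)]
      rfl
    have hlow : ∀ u ∈ Set.Icc (0 : ℝ) t, -(Λ * ((Λ * u) ^ k / k.factorial)) ≤
        ∫ ω, M.generator β c₀ c₁ f (X u.toNNReal ω) ∂P := fun u hu => by
      obtain ⟨C, hC⟩ := hbd
      have hbound := ih u.toNNReal
      rw [Real.coe_toNNReal u hu.1] at hbound
      have hmono : ∫ ω, -(Λ * {s : State m | n ≤ population s}.indicator 1 (X u.toNNReal ω)) ∂P ≤
          ∫ ω, M.generator β c₀ c₁ f (X u.toNNReal ω) ∂P := by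
        refine integral_mono ?_ ?_ fun ω => M.le_generator_indicator β c₀ c₁ n _
        · refine ((Integrable.of_bound (hX.measurable_comp _ _).aestronglyMeasurable 1
            (Eventually.of_forall fun ω => ?_)).const_mul _).neg
          by_cases h : n ≤ population (X u.toNNReal ω) <;> simp [h]
        · exact Integrable.of_bound (hX.measurable_comp _ _).aestronglyMeasurable C
            (Eventually.of_forall fun p => hC _)
      rw [integral_neg, integral_const_mul, hind] at hmono
      refine le_trans (neg_le_neg (mul_le_mul_of_nonneg_left hbound hΛ)) hmono
    have hint : -(Λ * t) ^ (k + 1) / (k + 1).factorial ≤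
        ∫ u in (0 : ℝ)..t, ∫ ω, M.generator β c₀ c₁ f (X u.toNNReal ω) ∂P := by
      have hcalc : ∫ u in (0 : ℝ)..t, -(Λ * ((Λ * u) ^ k / k.factorial)) =
          -(Λ * t) ^ (k + 1) / (k + 1).factorial := by
        have : ∀ u : ℝ, -(Λ * ((Λ * u) ^ k / k.factorial)) =
            -(Λ ^ (k + 1) / k.factorial) * u ^ k := fun u => by rw [mul_pow]; ring
        simp_rw [this]
        rw [intervalIntegral.integral_const_mul, integral_pow, Nat.factorial_succ]
        have : (k.factorial : ℝ) ≠ 0 := by positivity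
        push_cast
        field_simp
        simp [mul_pow]
      rw [← hcalc]
      obtain ⟨C, hC⟩ := hbd
      refine intervalIntegral.integral_mono_on t.2 (Continuous.intervalIntegrable (by fun_prop) _ _)
        ?_ hlow
      rw [intervalIntegrable_iff]
      exact (hX.integrable_uncurry hC 0 t).integral_prod_left
    have hcompl : P.real {ω | population s₀ + (k + 1) ≤ population (X t ω)} =
        1 - ∫ ω, f (X t ω) ∂P := by
      rw [hf, hind, ← probReal_compl_eq_one_sub (hmeas _ t)]
      congr 1
      ext ω
      simp [hn]
      omega
    rw [hcompl, hD, hs₀]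
    have : -(Λ * t) ^ (k + 1) / ((k + 1).factorial : ℝ) = -((Λ * t) ^ (k + 1) / (k + 1).factorial) := by
      ring
    linarith

end IsMarkovChain

lemma Model.generator_bound_nonneg (M : Model m) {C K : ℝ} (hC : 0 ≤ C) (hK : 0 ≤ K) :
    0 ≤ C * (∑ i, (2 * M.lam i + 4 * M.mu i)) * (2 * K) := by
  have : 0 ≤ ∑ i, (2 * M.lam i + 4 * M.mu i) := Finset.sum_nonneg fun i _ => by
    have := M.lam_pos i
    have := M.mu_pos i
    linarith
  positivity

namespace IsMarkovChain

variable {M : Model m} {β : ℝ} {c₀ c₁ : Fin m → ℝ} {s₀ : State m} {Ω : Type*}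
  {mΩ : MeasurableSpace Ω} {P : Measure Ω} [IsProbabilityMeasure P] {ℱ : Filtration ℝ≥0 mΩ}
  {X : ℝ≥0 → Ω → State m}

/-- The population has exponential moments, which are bounded on bounded time intervals. -/
lemma exists_integral_pow_population_le (hX : IsMarkovChain (M.generator β c₀ c₁) s₀ P ℱ X)
    {K : ℝ} (hK : 0 ≤ K) (T : ℝ≥0) :
    ∃ B, ∀ t ≤ T, Integrable (fun ω => K ^ population (X t ω)) P ∧
      ∫ ω, K ^ population (X t ω) ∂P ≤ B := by
  have hΛ : 0 ≤ ∑ i, M.lam i := Finset.sum_nonneg fun i _ => (M.lam_pos i).le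
  set Λ := ∑ i, M.lam i with hΛdef
  set n₀ := population s₀ with hn₀
  -- For `n < n₀` the truncated subtraction gives `p n = 1`, the trivial bound on a probability.
  set p : ℕ → ℝ := fun n => (Λ * T) ^ (n - n₀) / (n - n₀).factorial with hp
  have hp0 : ∀ n, 0 ≤ p n := fun n => by positivity
  have hsum : Summable fun n => K ^ n * p n := by
    rw [← summable_nat_add_iff n₀]
    refine ((Real.summable_pow_div_factorial (K * (Λ * T))).mul_left (K ^ n₀)).congr fun n => ?_
    simp only [hp, Nat.add_sub_cancel]
    rw [pow_add, mul_pow K]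
    ring
  have hnn : ∀ n, 0 ≤ K ^ n * p n := fun n => mul_nonneg (pow_nonneg hK n) (hp0 n)
  refine ⟨∑' n, K ^ n * p n, fun t ht => ?_⟩
  have hZ : Measurable fun ω => population (X t ω) :=
    (measurable_of_countable population).comp ((hX.measurable t).mono (ℱ.le t) le_rfl)
  have hlaw : ∀ n, P {ω | population (X t ω) = n} ≤ ENNReal.ofReal (p n) := fun n => by
    rw [← ENNReal.ofReal_toReal (measure_ne_top P {ω | population (X t ω) = n})]
    refine ENNReal.ofReal_le_ofReal ?_
    by_cases hn : n₀ ≤ n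
    · have h1 : P.real {ω | population (X t ω) = n} ≤
          P.real {ω | n₀ + (n - n₀) ≤ population (X t ω)} :=
        measureReal_mono fun ω hω => by
          have hω' : population (X t ω) = n := hω
          show n₀ + (n - n₀) ≤ population (X t ω)
          omega
      refine (h1.trans (hX.measureReal_population_ge_le (n - n₀) t)).trans ?_
      simp only [hp]
      gcongr
    · simp only [hp, Nat.sub_eq_zero_of_le (not_le.1 hn).le]
      rw [pow_zero, Nat.factorial_zero, Nat.cast_one, div_one]
      exact measureReal_le_one
  have hle : ∫⁻ ω, ENNReal.ofReal (K ^ population (X t ω)) ∂P ≤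
      ENNReal.ofReal (∑' n, K ^ n * p n) := by
    rw [← lintegral_map (f := fun n : ℕ => ENNReal.ofReal (K ^ n)) (measurable_of_countable _) hZ,
      lintegral_countable', ENNReal.ofReal_tsum_of_nonneg hnn hsum]
    refine ENNReal.tsum_le_tsum fun n => ?_
    rw [Measure.map_apply hZ (measurableSet_singleton n), ENNReal.ofReal_mul (pow_nonneg hK n)]
    gcongr
    exact hlaw n
  have hmeas : AEStronglyMeasurable (fun ω => K ^ population (X t ω)) P :=
    (hX.measurable_comp (fun s => K ^ population s) t).aestronglyMeasurable
  have hpos : 0 ≤ᵐ[P] fun ω => K ^ population (X t ω) :=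
    Eventually.of_forall fun ω => pow_nonneg hK _
  refine ⟨⟨hmeas, ?_⟩, ?_⟩
  · rw [hasFiniteIntegral_iff_ofReal hpos]
    exact hle.trans_lt ENNReal.ofReal_lt_top
  · rw [integral_eq_lintegral_of_nonneg_ae hpos hmeas]
    exact ENNReal.toReal_le_of_le_ofReal (tsum_nonneg hnn) hle

/-! ### Dynkin's formula and Grönwall's inequality under exponential growth. -/

variable {f : State m → ℝ} {C K : ℝ}

lemma integrable_comp (hX : IsMarkovChain (M.generator β c₀ c₁) s₀ P ℱ X) (hK : 0 ≤ K)
    (hf : ∀ s, |f s| ≤ C * K ^ population s) (t : ℝ≥0) : Integrable (fun ω => f (X t ω)) P := by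
  obtain ⟨B, hB⟩ := hX.exists_integral_pow_population_le hK t
  exact ((hB t le_rfl).1.const_mul C).mono' (hX.measurable_comp f t).aestronglyMeasurable
    (Eventually.of_forall fun ω => hf _)

lemma exists_abs_integral_le (hX : IsMarkovChain (M.generator β c₀ c₁) s₀ P ℱ X) (hC : 0 ≤ C)
    (hK : 0 ≤ K) (T : ℝ≥0) :
    ∃ B, ∀ t ≤ T, ∀ f : State m → ℝ, (∀ s, |f s| ≤ C * K ^ population s) →
      |∫ ω, f (X t ω) ∂P| ≤ B := by
  obtain ⟨B, hB⟩ := hX.exists_integral_pow_population_le hK T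
  refine ⟨C * B, fun t ht f hf => ?_⟩
  refine (norm_integral_le_of_norm_le (f := fun ω => f (X t ω)) ((hB t ht).1.const_mul C)
    (Eventually.of_forall fun ω => hf (X t ω))).trans ?_
  rw [integral_const_mul]
  exact mul_le_mul_of_nonneg_left (hB t ht).2 hC

lemma intervalIntegrable_integral (hX : IsMarkovChain (M.generator β c₀ c₁) s₀ P ℱ X)
    (hC : 0 ≤ C) (hK : 0 ≤ K) (hf : ∀ s, |f s| ≤ C * K ^ population s) (a b : ℝ) :
    IntervalIntegrable (fun u : ℝ => ∫ ω, f (X u.toNNReal ω) ∂P) volume a b := by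
  obtain ⟨B, hB⟩ := hX.exists_abs_integral_le hC hK (max a b).toNNReal
  refine (intervalIntegrable_const (c := B)).mono_fun'
    (hX.stronglyMeasurable_integral f).aestronglyMeasurable ?_
  refine (ae_restrict_mem measurableSet_uIoc).mono fun u hu => ?_
  exact hB _ (Real.toNNReal_le_toNNReal hu.2) f hf

/-- Dynkin's formula for functions of at most exponential growth. -/
lemma integral_eq_add_integral_generator (hX : IsMarkovChain (M.generator β c₀ c₁) s₀ P ℱ X)
    (hC : 0 ≤ C) (hK : 1 ≤ K) (hf : ∀ s, |f s| ≤ C * K ^ population s) (t : ℝ≥0) :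
    ∫ ω, f (X t ω) ∂P =
      f s₀ + ∫ u in (0 : ℝ)..t, ∫ ω, M.generator β c₀ c₁ f (X u.toNNReal ω) ∂P := by
  have hK0 : 0 ≤ K := by linarith
  -- The truncations obey the same growth bound as `f`, so their generators share one dominating
  -- function; dominated convergence passes to the limit in both the space and the time integral.
  set g : ℕ → State m → ℝ := fun n => {s : State m | population s < n}.indicator f with hg
  have hgle : ∀ n s, |g n s| ≤ C * K ^ population s := fun n s => by
    refine le_trans ?_ (hf s)
    by_cases h : population s < n <;> simp [hg, h]
  have hglim : ∀ s, Tendsto (fun n => g n s) atTop (𝓝 (f s)) := fun s => by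
    refine tendsto_const_nhds.congr' ?_
    filter_upwards [eventually_gt_atTop (population s)] with n hn
    simp [hg, hn]
  have hAlim : ∀ s, Tendsto (fun n => M.generator β c₀ c₁ (g n) s) atTop
      (𝓝 (M.generator β c₀ c₁ f s)) := fun s =>
    tendsto_finsetSum _ fun i _ =>
      (((((hglim _).sub (hglim _)).const_mul _)).add (((hglim _).sub (hglim _)).const_mul _)).add
        (((hglim _).sub (hglim _)).const_mul _)
  set C' := C * (∑ i, (2 * M.lam i + 4 * M.mu i)) * (2 * K) with hC'
  have hC'0 : 0 ≤ C' :=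
    M.generator_bound_nonneg hC (by linarith)
  have hAle : ∀ n s, |M.generator β c₀ c₁ (g n) s| ≤ C' * (2 * K) ^ population s := fun n =>
    M.abs_generator_le β c₀ c₁ hC hK (hgle n)
  have hdyn : ∀ n, ∫ ω, g n (X t ω) ∂P =
      g n s₀ + ∫ u in (0 : ℝ)..t, ∫ ω, M.generator β c₀ c₁ (g n) (X u.toNNReal ω) ∂P := fun n => by
    have hfin : (g n).support.Finite :=
      (finite_population_lt n).subset Set.support_indicator_subset
    exact hX.integral_eq_of_finite_support hfin (M.exists_abs_generator_le β c₀ c₁ hfin) t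
  have hlim : ∀ {h : ℕ → State m → ℝ} {h' : State m → ℝ} {D L : ℝ}, 0 ≤ L →
      (∀ n s, |h n s| ≤ D * L ^ population s) → (∀ s, Tendsto (fun n => h n s) atTop (𝓝 (h' s))) →
      ∀ u : ℝ≥0, Tendsto (fun n => ∫ ω, h n (X u ω) ∂P) atTop (𝓝 (∫ ω, h' (X u ω) ∂P)) := by
    intro h h' D L hL hle hlim u
    obtain ⟨B, hB⟩ := hX.exists_integral_pow_population_le hL u
    exact tendsto_integral_of_dominated_convergence (fun ω => D * L ^ population (X u ω))
      (fun n => (hX.measurable_comp (h n) u).aestronglyMeasurable) ((hB u le_rfl).1.const_mul D)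
      (fun n => Eventually.of_forall fun ω => hle n _) (Eventually.of_forall fun ω => hlim _)
  have h2K : 0 ≤ 2 * K := by linarith
  refine tendsto_nhds_unique (hlim hK0 hgle hglim t) ?_
  simp_rw [hdyn]
  refine (hglim s₀).add ?_
  obtain ⟨B, hB⟩ := hX.exists_abs_integral_le hC'0 h2K t
  refine intervalIntegral.tendsto_integral_filter_of_dominated_convergence (fun _ => B)
    (Eventually.of_forall fun n => (hX.stronglyMeasurable_integral _).aestronglyMeasurable)
    (Eventually.of_forall fun n => Eventually.of_forall fun u hu => ?_) intervalIntegrable_const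
    (Eventually.of_forall fun u _ => hlim h2K hAle hAlim _)
  rw [Set.uIoc_of_le (NNReal.coe_nonneg t)] at hu
  exact hB _ (Real.toNNReal_le_iff_le_coe.2 hu.2) _ (hAle n)

lemma continuous_integral (hX : IsMarkovChain (M.generator β c₀ c₁) s₀ P ℱ X)
    (hC : 0 ≤ C) (hK : 1 ≤ K) (hf : ∀ s, |f s| ≤ C * K ^ population s) :
    Continuous fun u : ℝ => ∫ ω, f (X u.toNNReal ω) ∂P := by
  simp_rw [hX.integral_eq_add_integral_generator hC hK hf]
  have hAle := M.abs_generator_le β c₀ c₁ hC hK hf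
  have hC' : 0 ≤ C * (∑ i, (2 * M.lam i + 4 * M.mu i)) * (2 * K) :=
    M.generator_bound_nonneg hC (by linarith)
  exact continuous_const.add ((intervalIntegral.continuous_primitive
    (hX.intervalIntegrable_integral hC' (by linarith) hAle) 0).comp
      (NNReal.continuous_coe.comp continuous_real_toNNReal))

/-- Grönwall's inequality for the expectation of a function of at most exponential growth. -/
lemma integral_le_of_integral_generator_le (hX : IsMarkovChain (M.generator β c₀ c₁) s₀ P ℱ X)
    (hC : 0 ≤ C) (hK : 1 ≤ K) (hf : ∀ s, |f s| ≤ C * K ^ population s) {κ L : ℝ}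
    (hgen : ∀ u, ∫ ω, M.generator β c₀ c₁ f (X u ω) ∂P ≤ κ * (L - ∫ ω, f (X u ω) ∂P)) (t : ℝ≥0) :
    ∫ ω, f (X t ω) ∂P ≤ L + (f s₀ - L) * Real.exp (-(κ * t)) := by
  have hAle := M.abs_generator_le β c₀ c₁ hC hK hf
  have hC' : 0 ≤ C * (∑ i, (2 * M.lam i + 4 * M.mu i)) * (2 * K) :=
    M.generator_bound_nonneg hC (by linarith)
  set h : ℝ → ℝ := fun u => ∫ ω, M.generator β c₀ c₁ f (X u.toNNReal ω) ∂P with hh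
  have hcont : Continuous h := hX.continuous_integral hC' (by linarith) hAle
  set q : ℝ → ℝ := fun u => f s₀ + ∫ v in (0 : ℝ)..u, h v with hq
  have hqt : ∀ u : ℝ≥0, q u = ∫ ω, f (X u ω) ∂P := fun u =>
    (hX.integral_eq_add_integral_generator hC hK hf u).symm
  have hderiv : ∀ u, HasDerivAt (fun u => Real.exp (κ * u) * (q u - L))
      (Real.exp (κ * u) * κ * (q u - L) + Real.exp (κ * u) * h u) u := fun u => by
    have h1 : HasDerivAt q (h u) u :=
      (intervalIntegral.integral_hasDerivAt_right (hcont.intervalIntegrable _ _)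
        (hcont.stronglyMeasurableAtFilter _ _) hcont.continuousAt).const_add _
    have h2 : HasDerivAt (fun u => Real.exp (κ * u)) (Real.exp (κ * u) * κ) u := by
      simpa using ((hasDerivAt_id u).const_mul κ).exp
    exact h2.mul (h1.sub_const L)
  have hanti : AntitoneOn (fun u => Real.exp (κ * u) * (q u - L)) (Set.Ici 0) := by
    refine antitoneOn_of_deriv_nonpos (convex_Ici 0)
      (fun u _ => (hderiv u).continuousAt.continuousWithinAt)
      (fun u _ => (hderiv u).differentiableAt.differentiableWithinAt) fun u hu => ?_
    rw [interior_Ici] at hu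
    have hu0 : 0 ≤ u := le_of_lt hu
    have h1 := hgen u.toNNReal
    rw [← hqt, Real.coe_toNNReal u hu0] at h1
    have h2 : h u ≤ κ * (L - q u) := h1
    rw [(hderiv u).deriv]
    have := Real.exp_pos (κ * u)
    nlinarith
  have hle := hanti (Set.mem_Ici.2 le_rfl) (Set.mem_Ici.2 (NNReal.coe_nonneg t))
    (NNReal.coe_nonneg t)
  have hq0 : q 0 = f s₀ := by simp [hq]
  simp only [hqt, hq0, mul_zero, Real.exp_zero, one_mul] at hle
  rw [Real.exp_neg]
  have hpos := Real.exp_pos (κ * (t : ℝ))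
  have : (∫ ω, f (X t ω) ∂P) - L ≤ (f s₀ - L) * (Real.exp (κ * t))⁻¹ := by
    rw [← div_eq_mul_inv, le_div_iff₀ hpos]
    linarith
  linarith

end IsMarkovChain

/-! ### The shifted minimum and its drift. -/

section ShiftMin

/-- The least value of `G` when `k` customers are moved from the second to the first coordinate at
the price `c` each. -/
noncomputable def shiftMin (c : ℝ) (G : ℕ → ℕ → ℝ) (x y : ℕ) : ℝ :=
  (Finset.range (y + 1)).inf' ⟨0, Finset.mem_range.2 y.succ_pos⟩ fun k => c * k + G (x + k) (y - k)

variable {c : ℝ} {G : ℕ → ℕ → ℝ}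

lemma shiftMin_le {x y k X Y : ℕ} (hX : x + k = X) (hY : Y + k = y) :
    shiftMin c G x y ≤ c * k + G X Y := by
  obtain rfl : Y = y - k := by omega
  subst hX
  exact Finset.inf'_le _ (Finset.mem_range.2 (by omega))

lemma exists_shiftMin_eq (c : ℝ) (G : ℕ → ℕ → ℝ) (x y : ℕ) :
    ∃ k Y, Y + k = y ∧ shiftMin c G x y = c * k + G (x + k) Y := by
  obtain ⟨k, hk, h⟩ := Finset.exists_mem_eq_inf' (s := Finset.range (y + 1))
    ⟨0, Finset.mem_range.2 y.succ_pos⟩ fun k : ℕ => c * k + G (x + k) (y - k)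
  rw [Finset.mem_range] at hk
  exact ⟨k, y - k, by omega, h⟩

open Classical in
/-- If `G` decreases in mean to `W` for a class that is admitted exactly when `acc` holds, then
`shiftMin c G` does so up to a term proportional to `c` for the class that is
admitted when, in addition, there is room. -/
lemma drift_shiftMin_le {acc : ℕ → ℕ → Prop} {lam mu W : ℝ} (hc : 0 ≤ c) (hlam : 0 ≤ lam)
    (hmu : 0 ≤ mu) (hacc : ∀ x y k, acc (x + k) y → acc x (y + k))
    (hG : ∀ x y : ℕ, lam * ((if acc x y then G (x + 1) y else G x (y + 1)) - G x y)
      + mu * x * (G (x - 1) y - G x y) + mu * y * (G x (y - 1) - G x y) ≤ mu * (W - G x y))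
    (room : Prop) (x y : ℕ) :
    lam * ((if acc x y ∧ room then shiftMin c G (x + 1) y else shiftMin c G x (y + 1))
        - shiftMin c G x y)
      + mu * x * (shiftMin c G (x - 1) y - shiftMin c G x y)
      + mu * y * (shiftMin c G x (y - 1) - shiftMin c G x y) ≤
    mu * (W - shiftMin c G x y) + lam * (c * if room then 0 else 1) := by
  -- Fix an optimal shift `k` at the current state. After each transition a suitable competing shift
  -- bounds the new minimum, so that the shifted configuration `(x + k, Y)` appears to evolve by the
  -- unconstrained dynamics.
  obtain ⟨k, Y, hY, hF⟩ := exists_shiftMin_eq c G x y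
  subst hY
  have hGk := hG (x + k) Y
  have harr : (if acc x (Y + k) ∧ room then shiftMin c G (x + 1) (Y + k)
      else shiftMin c G x (Y + k + 1)) ≤
      c * k + (if acc (x + k) Y then G (x + k + 1) Y else G (x + k) (Y + 1))
        + c * if room then 0 else 1 := by
    by_cases hr : room
    · simp only [hr, and_true, if_true, mul_zero, add_zero]
      by_cases h1 : acc (x + k) Y
      · rw [if_pos h1, if_pos (hacc _ _ _ h1)]
        exact shiftMin_le (by omega) rfl
      · rw [if_neg h1]
        split_ifs with h2
        -- The real request joins the first coordinate although the shifted configuration would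
        -- reject it. Then `k > 0`, and shifting one customer fewer gives `(x + k, Y + 1)` and saves
        -- `c ≥ 0`.
        · obtain _ | j := k
          · exact absurd h2 h1
          · have := shiftMin_le (c := c) (G := G) (x := x + 1) (y := Y + (j + 1)) (k := j)
              (X := x + (j + 1)) (Y := Y + 1) (by omega) (by omega)
            push_cast
            linarith
        · exact shiftMin_le rfl (by omega)
    · simp only [hr, and_false, if_false, mul_one]
      split_ifs with h1
      -- A forced rejection: shifting one customer more undoes it, and this is the only place where
      -- an extra `c` is paid.
      · have := shiftMin_le (c := c) (G := G) (x := x) (y := Y + k + 1) (k := k + 1)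
          (X := x + k + 1) (Y := Y) (by omega) (by omega)
        push_cast at this
        linarith
      · have := shiftMin_le (c := c) (G := G) (x := x) (y := Y + k + 1) (k := k)
          (X := x + k) (Y := Y + 1) (by omega) (by omega)
        linarith
  have hdx : (x : ℝ) * (shiftMin c G (x - 1) (Y + k) - shiftMin c G x (Y + k)) ≤
      x * (G (x + k - 1) Y - G (x + k) Y) := by
    obtain _ | j := x
    · simp
    · refine mul_le_mul_of_nonneg_left ?_ (Nat.cast_nonneg _)
      rw [hF]
      have := shiftMin_le (c := c) (G := G) (x := j) (y := Y + k) (k := k)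
        (X := j + 1 + k - 1) (Y := Y) (by omega) (by omega)
      simp only [Nat.add_sub_cancel]
      linarith
  have hdY : (Y : ℝ) * (shiftMin c G x (Y + k - 1) - shiftMin c G x (Y + k)) ≤
      Y * (G (x + k) (Y - 1) - G (x + k) Y) := by
    obtain _ | j := Y
    · simp
    · refine mul_le_mul_of_nonneg_left ?_ (Nat.cast_nonneg _)
      rw [hF]
      have := shiftMin_le (c := c) (G := G) (x := x) (y := j + 1 + k - 1) (k := k)
        (X := x + k) (Y := j) (by omega) (by omega)
      simp only [Nat.add_sub_cancel]
      linarith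
  -- The `k` shifted customers leave system 1 but count as departures from the first coordinate of
  -- `(x + k, Y)`. Each refunds its price `c`, which turns `W - G` into `W - (c * k + G)`.
  have hdk : (k : ℝ) * (shiftMin c G x (Y + k - 1) - shiftMin c G x (Y + k)) ≤
      k * (G (x + k - 1) Y - G (x + k) Y - c) := by
    obtain _ | j := k
    · simp
    · refine mul_le_mul_of_nonneg_left ?_ (Nat.cast_nonneg _)
      rw [hF]
      have := shiftMin_le (c := c) (G := G) (x := x) (y := Y + (j + 1) - 1) (k := j)
        (X := x + (j + 1) - 1) (Y := Y) (by omega) (by omega)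
      push_cast
      linarith
  have e1 := mul_le_mul_of_nonneg_left harr hlam
  have e2 := mul_le_mul_of_nonneg_left hdx hmu
  have e3 := mul_le_mul_of_nonneg_left hdY hmu
  have e4 := mul_le_mul_of_nonneg_left hdk hmu
  rw [hF] at e2 e3 e4 ⊢
  push_cast at hGk ⊢
  linarith

end ShiftMin

/-! ### Drift of the exponential penalty without a capacity constraint. -/

section Exponential

lemma exp_sub_one_le {a ε : ℝ} (ha : 0 ≤ a) (haε : a ≤ ε) (hε : ε ≤ 1) :
    Real.exp a - 1 ≤ (1 + ε) * a := by
  have := (abs_le.1 (Real.abs_exp_sub_one_sub_id_le (by rw [abs_of_nonneg ha]; linarith))).2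
  nlinarith

lemma exp_neg_sub_one_le {a ε : ℝ} (ha : 0 ≤ a) (haε : a ≤ ε) :
    Real.exp (-a) - 1 ≤ -((1 - ε / 2) * a) := by
  have h1 := Real.quadratic_le_exp_of_nonneg ha
  have h2 : Real.exp (-a) ≤ 1 - a + a ^ 2 / 2 := by
    rw [Real.exp_neg, inv_le_comm₀ (Real.exp_pos a) (by nlinarith [sq_nonneg (a - 1)])]
    refine le_trans ?_ h1
    rw [inv_le_iff_one_le_mul₀ (by nlinarith [sq_nonneg (a - 1)])]
    nlinarith [sq_nonneg (a ^ 2)]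
  nlinarith

/-- The drift of `exp` along a class of target load at most `β / (1 + 4 ε)`. -/
lemma exp_mul_le {ε β : ℝ} (hε : 0 < ε) (hε' : ε < 1 / 4) (hβ : 4 ≤ β) (u : ℝ) :
    Real.exp u * ((1 + ε) * (β / (1 + 4 * ε)) - (1 - ε / 2) * u) ≤
      Real.exp (β * (1 - ε / 2)) - Real.exp u := by
  set L := β * (1 - ε / 2) with hL
  -- The gap between the two loads is of order `ε β`; with `β ≥ 4` it covers the constant `ε / 2`,
  -- which is what the case split at `L + 1` below consumes.
  have hA : (1 + ε) * (β / (1 + 4 * ε)) ≤ (1 - ε / 2) * L - ε / 2 := by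
    rw [← mul_div_assoc, div_le_iff₀ (by linarith), hL]
    have h1 : (1 - ε / 2) * (1 - ε / 2) * (1 + 4 * ε) - (1 + ε) = ε * (2 - 15 / 4 * ε + ε ^ 2) := by
      ring
    have h2 : 4 * (ε * (2 - 15 / 4 * ε + ε ^ 2)) ≤ β * (ε * (2 - 15 / 4 * ε + ε ^ 2)) :=
      mul_le_mul_of_nonneg_right hβ (mul_nonneg hε.le (by nlinarith))
    have h3 : ε / 2 * (1 + 4 * ε) ≤ 4 * (ε * (2 - 15 / 4 * ε + ε ^ 2)) := by nlinarith
    nlinarith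
  set A := (1 + ε) * (β / (1 + 4 * ε))
  suffices h : A + 1 - (1 - ε / 2) * u ≤ Real.exp (L - u) by
    have := mul_le_mul_of_nonneg_left h (Real.exp_pos u).le
    rw [← Real.exp_add, add_sub_cancel] at this
    linarith
  have h1 := Real.add_one_le_exp (L - u)
  -- Up to `L + 1` the tangent bound for `exp` suffices; beyond it the left-hand side is no longer
  -- positive.
  by_cases hu : u ≤ L + 1
  · nlinarith
  · have := Real.exp_pos (L - u)
    nlinarith

lemma exp_add_one_sub_le {a ε : ℝ} (ha : 0 ≤ a) (haε : a ≤ ε) (hε : ε ≤ 1) (x : ℕ) :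
    Real.exp (a * (x + 1 : ℕ)) - Real.exp (a * x) ≤ (1 + ε) * (a * Real.exp (a * x)) := by
  have h := mul_le_mul_of_nonneg_left (exp_sub_one_le ha haε hε) (Real.exp_pos (a * x)).le
  rw [Nat.cast_add_one, mul_add_one, Real.exp_add]
  linarith

lemma mul_exp_sub_one_sub_le {a ε : ℝ} (ha : 0 ≤ a) (haε : a ≤ ε) (x : ℕ) :
    (x : ℝ) * (Real.exp (a * (x - 1 : ℕ)) - Real.exp (a * x)) ≤
      -(Real.exp (a * x) * ((1 - ε / 2) * (a * x))) := by
  obtain _ | j := x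
  · simp
  · have h := mul_le_mul_of_nonneg_left (exp_neg_sub_one_le ha haε)
      (mul_nonneg (Nat.cast_nonneg (j + 1)) (Real.exp_pos (a * (j + 1 : ℕ))).le)
    have e : Real.exp (a * (j : ℕ)) = Real.exp (a * (j + 1 : ℕ)) * Real.exp (-a) := by
      rw [← Real.exp_add]; congr 1; push_cast; ring
    rw [Nat.add_sub_cancel, e]
    linarith

/-- The sum of the exponential penalties of the two systems. -/
noncomputable def expPair (a d : ℝ) (x y : ℕ) : ℝ := Real.exp (a * x) + Real.exp (d * y)

variable {ε β a d ρ mu α : ℝ}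

open Classical in
-- The smaller of the marginal penalties `S`, `T` is at most their average `α S + (1 - α) T`. By
-- `hab` and `hdb` this average, times `ρ`, is `β / (1 + 4 ε)` times the penalty itself, so the two
-- exponentials decouple and `exp_mul_le` applies to each.
lemma drift_expPair_le (hε : 0 < ε) (hε' : ε < 1 / 4) (hβ : 4 ≤ β) (hmu : 0 ≤ mu) (hρ : 0 ≤ ρ)
    (hα : 0 ≤ α) (hα' : α ≤ 1) (ha : 0 ≤ a) (haε : a ≤ ε) (hd : 0 ≤ d) (hdε : d ≤ ε)
    (hab : ρ * α * a = β / (1 + 4 * ε)) (hdb : ρ * (1 - α) * d = β / (1 + 4 * ε)) (x y : ℕ) :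
    mu * ρ * ((if a * Real.exp (a * x) ≤ d * Real.exp (d * y) then expPair a d (x + 1) y
        else expPair a d x (y + 1)) - expPair a d x y)
      + mu * x * (expPair a d (x - 1) y - expPair a d x y)
      + mu * y * (expPair a d x (y - 1) - expPair a d x y) ≤
    mu * (2 * Real.exp (β * (1 - ε / 2)) - expPair a d x y) := by
  set S := a * Real.exp (a * x) with hS
  set T := d * Real.exp (d * y) with hT
  set γ := β / (1 + 4 * ε) with hγ
  have hαS : ρ * α * S = γ * Real.exp (a * x) := by rw [hS, ← hab]; ring
  have hαT : ρ * (1 - α) * T = γ * Real.exp (d * y) := by rw [hT, ← hdb]; ring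
  have h1 : ρ * ((if S ≤ T then expPair a d (x + 1) y else expPair a d x (y + 1)) -
      expPair a d x y) ≤ (1 + ε) * (γ * Real.exp (a * x) + γ * Real.exp (d * y)) := by
    rw [← hαS, ← hαT]
    have hρα := mul_nonneg hρ hα
    have hρα' := mul_nonneg hρ (sub_nonneg.2 hα')
    split_ifs with h
    · have e1 := mul_le_mul_of_nonneg_left (exp_add_one_sub_le ha haε (by linarith) x) hρ
      have e2 := mul_le_mul_of_nonneg_left (mul_le_mul_of_nonneg_left h hρα')
        (by linarith : 0 ≤ 1 + ε)
      simp only [expPair]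
      linarith
    · have e1 := mul_le_mul_of_nonneg_left (exp_add_one_sub_le hd hdε (by linarith) y) hρ
      have e2 := mul_le_mul_of_nonneg_left (mul_le_mul_of_nonneg_left (not_le.1 h).le hρα)
        (by linarith : 0 ≤ 1 + ε)
      simp only [expPair]
      linarith
  have h2 := mul_exp_sub_one_sub_le ha haε x
  have h3 := mul_exp_sub_one_sub_le hd hdε y
  have h4 := exp_mul_le hε hε' hβ (a * x)
  have h5 := exp_mul_le hε hε' hβ (d * y)
  have h6 : ρ * ((if S ≤ T then expPair a d (x + 1) y else expPair a d x (y + 1)) -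
      expPair a d x y) + x * (expPair a d (x - 1) y - expPair a d x y)
      + y * (expPair a d x (y - 1) - expPair a d x y) ≤
      2 * Real.exp (β * (1 - ε / 2)) - expPair a d x y := by
    simp only [expPair] at h1 ⊢
    linarith
  have := mul_le_mul_of_nonneg_left h6 hmu
  linarith

/-- The case `α = 1`: the second exponential is the constant 1, which lies below its share `exp (β
(1 - ε/2))` of the equilibrium level. -/
lemma drift_expPair_zero_le (hε : 0 < ε) (hε' : ε < 1 / 4) (hβ : 4 ≤ β) (hmu : 0 ≤ mu)
    (hρ : 0 ≤ ρ) (ha : 0 ≤ a) (haε : a ≤ ε) (hab : ρ * a = β / (1 + 4 * ε)) (x y : ℕ) :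
    mu * ρ * (expPair a 0 (x + 1) y - expPair a 0 x y)
      + mu * x * (expPair a 0 (x - 1) y - expPair a 0 x y)
      + mu * y * (expPair a 0 x (y - 1) - expPair a 0 x y) ≤
    mu * (2 * Real.exp (β * (1 - ε / 2)) - expPair a 0 x y) := by
  have h1 := mul_le_mul_of_nonneg_left (exp_add_one_sub_le ha haε (by linarith) x) hρ
  have h1' : ρ * ((1 + ε) * (a * Real.exp (a * x))) =
      (1 + ε) * (β / (1 + 4 * ε)) * Real.exp (a * x) := by rw [← hab]; ring
  have h2 := mul_exp_sub_one_sub_le ha haε x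
  have h4 := exp_mul_le hε hε' hβ (a * x)
  have h5 : 1 ≤ Real.exp (β * (1 - ε / 2)) :=
    Real.one_le_exp (mul_nonneg (by linarith) (by linarith))
  have h6 : ρ * (expPair a 0 (x + 1) y - expPair a 0 x y)
      + x * (expPair a 0 (x - 1) y - expPair a 0 x y)
      + y * (expPair a 0 x (y - 1) - expPair a 0 x y) ≤
      2 * Real.exp (β * (1 - ε / 2)) - expPair a 0 x y := by
    simp only [expPair, zero_mul, Real.exp_zero]
    linarith
  have := mul_le_mul_of_nonneg_left h6 hmu
  linarith

end Exponential

/-! ### Single-class form of the dynamics, and the event of a full resource. -/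

namespace Model

variable (M : Model m)

lemma rho_pos (i : Fin m) : 0 < M.rho i := div_pos (M.lam_pos i) (M.mu_pos i)

lemma mu_mul_rho (i : Fin m) : M.mu i * M.rho i = M.lam i :=
  mul_div_cancel₀ _ (M.mu_pos i).ne'

lemma penaltyAccepts_iff (β : ℝ) (c₀ c₁ : Fin m → ℝ) (i : Fin m) (s : State m) :
    M.PenaltyAccepts β c₀ c₁ i s ↔ c₁ i = 0 ∨
      β * M.req i / c₀ i * Real.exp (β * M.req i / c₀ i * s.1 i) ≤
        β * M.req i / c₁ i * Real.exp (β * M.req i / c₁ i * s.2 i) := by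
  have h : ∀ (c v : ℝ), HasDerivAt (fun u : ℝ => Real.exp (β * (M.req i * u / c)))
      (β * M.req i / c * Real.exp (β * M.req i / c * v)) v := fun c v => by
    have h1 : HasDerivAt (fun u : ℝ => β * M.req i / c * u) (β * M.req i / c) v := by
      simpa using (hasDerivAt_id v).const_mul (β * M.req i / c)
    have h2 : (fun u : ℝ => Real.exp (β * (M.req i * u / c))) =
        fun u => Real.exp (β * M.req i / c * u) := by
      ext u; congr 1; ring
    rw [h2]
    exact h1.exp.congr_deriv (mul_comm _ _)
  unfold PenaltyAccepts penalty
  rw [((h (c₀ i) (s.1 i)).add_const _).deriv, ((h (c₁ i) (s.2 i)).const_add _).deriv]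

open Classical in
/-- The generator on functions of the numbers of customers of a single class. -/
lemma generator_class (β : ℝ) (c₀ c₁ : Fin m → ℝ) (i : Fin m) (φ : ℕ → ℕ → ℝ) (s : State m) :
    M.generator β c₀ c₁ (fun s => φ (s.1 i) (s.2 i)) s =
      M.lam i * ((if M.PenaltyAccepts β c₀ c₁ i s ∧ M.HasRoom i s then φ (s.1 i + 1) (s.2 i)
        else φ (s.1 i) (s.2 i + 1)) - φ (s.1 i) (s.2 i))
      + M.mu i * s.1 i * (φ (s.1 i - 1) (s.2 i) - φ (s.1 i) (s.2 i))
      + M.mu i * s.2 i * (φ (s.1 i) (s.2 i - 1) - φ (s.1 i) (s.2 i)) := by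
  unfold generator
  rw [Finset.sum_eq_single i]
  · unfold afterArrival
    split_ifs <;> simp
  · intro j _ hj
    unfold afterArrival
    split_ifs <;> simp [Pi.single_eq_of_ne hj.symm]
  · simp

open Classical in
/-- Markov's inequality for the event that there is no room for a class `i` request. -/
lemma noRoom_le {ε β : ℝ} {c₀ : Fin m → ℝ} (hc : ∀ j, 0 < c₀ j) (hβ : 0 ≤ β)
    (hsum : ∑ j, c₀ j ≤ M.cap) (i : Fin m) (hi : β * M.req i ≤ ε * M.cap) (s : State m) :
    (if M.HasRoom i s then (0 : ℝ) else 1) ≤ Real.exp (ε - β) *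
      (∑ j, c₀ j / M.cap * Real.exp (β * M.req j / c₀ j * s.1 j) + (1 - ∑ j, c₀ j / M.cap)) := by
  have hcap := M.cap_pos
  have hsum' : ∑ j, c₀ j / M.cap ≤ 1 := by
    rw [← Finset.sum_div, div_le_one hcap]; exact hsum
  split_ifs with h
  · have : 0 ≤ ∑ j, c₀ j / M.cap * Real.exp (β * M.req j / c₀ j * s.1 j) :=
      Finset.sum_nonneg fun j _ => by have := hc j; positivity
    exact mul_nonneg (Real.exp_pos _).le (by linarith)
  · unfold HasRoom at h
    rw [not_le] at h
    set u : Fin m → ℝ := fun j => β * M.req j / c₀ j * s.1 j with hu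
    set v := β / M.cap * ∑ j, M.req j * (s.1 j : ℝ) with hv
    have hwu : ∑ j, c₀ j / M.cap * u j = v := by
      rw [hv, Finset.mul_sum]
      refine Finset.sum_congr rfl fun j _ => ?_
      -- The weights `c₀ j / cap` make the average of the exponents `u j` a multiple of the total
      -- occupied capacity.
      have := (hc j).ne'
      simp only [hu]
      field_simp
    have hvb : β - ε ≤ v := by
      have h1 : β * M.cap ≤ β * (∑ j, M.req j * (s.1 j : ℝ)) + β * M.req i := by
        rw [← mul_add]; exact mul_le_mul_of_nonneg_left h.le hβ
      rw [hv, div_mul_eq_mul_div, le_div_iff₀ hcap]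
      linarith
    have htan : ∀ w, Real.exp v * (1 + w - v) ≤ Real.exp w := fun w => by
      have := mul_le_mul_of_nonneg_left (Real.add_one_le_exp (w - v)) (Real.exp_pos v).le
      rw [← Real.exp_add, add_sub_cancel] at this
      linarith
    -- Jensen's inequality by the tangent at `v`; the weights may sum to less than one, and the
    -- missing mass sits at the point 0, where `exp` is 1.
    have hjensen : Real.exp v ≤
        ∑ j, c₀ j / M.cap * Real.exp (u j) + (1 - ∑ j, c₀ j / M.cap) := by
      have h1 : ∑ j, c₀ j / M.cap * (Real.exp v * (1 + u j - v)) ≤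
          ∑ j, c₀ j / M.cap * Real.exp (u j) :=
        Finset.sum_le_sum fun j _ =>
          mul_le_mul_of_nonneg_left (htan _) (div_nonneg (hc j).le hcap.le)
      have h2 : ∑ j, c₀ j / M.cap * (Real.exp v * (1 + u j - v)) =
          Real.exp v * ((∑ j, c₀ j / M.cap) * (1 - v) + v) := by
        rw [← hwu, Finset.sum_mul, ← Finset.sum_add_distrib, Finset.mul_sum, hwu]
        exact Finset.sum_congr rfl fun j _ => by ring
      have h3 := mul_le_mul_of_nonneg_left (htan 0) (sub_nonneg.2 hsum')
      rw [Real.exp_zero] at h3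
      linarith
    calc (1 : ℝ) = Real.exp (ε - β) * Real.exp (β - ε) := by rw [← Real.exp_add]; simp
      _ ≤ Real.exp (ε - β) * Real.exp v := by gcongr
      _ ≤ _ := by gcongr

end Model

namespace IsMarkovChain

variable {M : Model m} {β : ℝ} {c₀ c₁ : Fin m → ℝ} {s₀ : State m} {Ω : Type*}
  {mΩ : MeasurableSpace Ω} {P : Measure Ω} [IsProbabilityMeasure P] {ℱ : Filtration ℝ≥0 mΩ}
  {X : ℝ≥0 → Ω → State m}

open Classical in
lemma integral_noRoom_le_one (i : Fin m) (u : ℝ≥0) :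
    ∫ ω, (if M.HasRoom i (X u ω) then (0 : ℝ) else 1) ∂P ≤ 1 := by
  have h : ‖∫ ω, (if M.HasRoom i (X u ω) then (0 : ℝ) else 1) ∂P‖ ≤ 1 * P.real Set.univ :=
    norm_integral_le_of_norm_le_const (Eventually.of_forall fun ω => by split_ifs <;> simp)
  rw [probReal_univ, mul_one] at h
  exact (le_abs_self _).trans h

open Classical in
-- Since `λ_i = μ_i ρ_i`, a bound `δ` on the probability of no room merely raises the equilibrium
-- level from `L` to `L + ρ_i q δ`.
lemma integral_le_of_generator_le (hX : IsMarkovChain (M.generator β c₀ c₁) s₀ P ℱ X)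
    {f : State m → ℝ} {C K : ℝ} (hC : 0 ≤ C) (hK : 1 ≤ K)
    (hf : ∀ s, |f s| ≤ C * K ^ population s) (i : Fin m) {L q δ : ℝ} (hq : 0 ≤ q)
    (hgen : ∀ s, M.generator β c₀ c₁ f s ≤
      M.mu i * (L - f s) + M.lam i * (q * if M.HasRoom i s then 0 else 1))
    (hδ : ∀ u, ∫ ω, (if M.HasRoom i (X u ω) then (0 : ℝ) else 1) ∂P ≤ δ) (t : ℝ≥0) :
    ∫ ω, f (X t ω) ∂P ≤ L + M.rho i * q * δ +
      (f s₀ - (L + M.rho i * q * δ)) * Real.exp (-(M.mu i * t)) := by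
  refine hX.integral_le_of_integral_generator_le hC hK hf (fun u => ?_) t
  have hfi := hX.integrable_comp (by linarith) hf u
  have hroom : Integrable (fun ω => if M.HasRoom i (X u ω) then (0 : ℝ) else 1) P :=
    Integrable.of_bound
      (hX.measurable_comp (fun s => if M.HasRoom i s then (0 : ℝ) else 1) u).aestronglyMeasurable 1
      (Eventually.of_forall fun ω => by split_ifs <;> simp)
  have hAi := hX.integrable_comp (by linarith) (M.abs_generator_le β c₀ c₁ hC hK hf) u
  have h1 : Integrable (fun ω => M.mu i * (L - f (X u ω))) P :=
    ((integrable_const L).sub hfi).const_mul _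
  have h2 : Integrable (fun ω => M.lam i * (q * if M.HasRoom i (X u ω) then (0 : ℝ) else 1)) P :=
    (hroom.const_mul _).const_mul _
  have h3 := integral_mono hAi (h1.add h2) fun ω => hgen (X u ω)
  simp only [Pi.add_apply] at h3
  rw [integral_add h1 h2, integral_const_mul, integral_const_mul, integral_const_mul,
    integral_sub (integrable_const L) hfi, integral_const] at h3
  have h4 := mul_le_mul_of_nonneg_left (hδ u) (mul_nonneg (M.lam_pos i).le hq)
  have h5 := M.mu_mul_rho i
  simp only [probReal_univ, one_smul] at h3
  rw [← h5] at h3 h4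
  linarith

end IsMarkovChain

/-! ### Bounds on the shifted minimum of the exponential penalty. -/

section ShiftMinExpPair

variable {c a d : ℝ}

lemma expPair_nonneg (a d : ℝ) (x y : ℕ) : 0 ≤ expPair a d x y :=
  add_nonneg (Real.exp_pos _).le (Real.exp_pos _).le

lemma shiftMin_expPair_nonneg (hc : 0 ≤ c) (a d : ℝ) (x y : ℕ) :
    0 ≤ shiftMin c (expPair a d) x y := by
  obtain ⟨k, Y, -, h⟩ := exists_shiftMin_eq c (expPair a d) x y
  rw [h]
  exact add_nonneg (mul_nonneg hc k.cast_nonneg) (expPair_nonneg _ _ _ _)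

lemma exp_le_shiftMin_expPair (hc : 0 ≤ c) (ha : 0 ≤ a) (d : ℝ) (x y : ℕ) :
    Real.exp (a * x) ≤ shiftMin c (expPair a d) x y := by
  obtain ⟨k, Y, -, h⟩ := exists_shiftMin_eq c (expPair a d) x y
  rw [h]
  have h1 : Real.exp (a * x) ≤ Real.exp (a * (x + k : ℕ)) := by
    gcongr
    exact Nat.le_add_right _ _
  have h2 := Real.exp_pos (d * Y)
  have h3 := mul_nonneg hc (k.cast_nonneg (α := ℝ))
  unfold expPair
  linarith

/-- The tangent to `exp (d * y)` at the height `W` has slope `d * W`. Taking this slope as the price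
makes each shifted customer cost exactly what it removes from the affine bound, so the bound holds
for every shift. -/
lemma mul_le_shiftMin_expPair {W : ℝ} (hW : 0 < W) (a d : ℝ) (x y : ℕ) :
    d * W * y ≤ shiftMin (d * W) (expPair a d) x y - W + W * Real.log W := by
  obtain ⟨k, Y, hY, h⟩ := exists_shiftMin_eq (d * W) (expPair a d) x y
  rw [h, ← hY]
  have h1 := mul_le_mul_of_nonneg_left (Real.add_one_le_exp (d * Y - Real.log W)) hW.le
  rw [Real.exp_sub, Real.exp_log hW, mul_div_cancel₀ _ hW.ne'] at h1
  have h2 := Real.exp_pos (a * (x + k : ℕ))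
  unfold expPair
  push_cast at h2 ⊢
  linarith

lemma abs_shiftMin_expPair_le (hc : 0 ≤ c) (ha : a ≤ 1) (hd : d ≤ 1)
    (i : Fin m) (s : State m) :
    |shiftMin c (expPair a d) (s.1 i) (s.2 i)| ≤ 2 * Real.exp 1 ^ population s := by
  rw [abs_of_nonneg (shiftMin_expPair_nonneg hc _ _ _ _), ← Real.exp_nat_mul, mul_one]
  have h1 := shiftMin_le (c := c) (G := expPair a d) (x := s.1 i) (y := s.2 i) (k := 0) rfl rfl
  have h2 : ((s.1 i + s.2 i : ℕ) : ℝ) ≤ population s := by exact_mod_cast le_population s i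
  push_cast at h2
  have hx := (s.1 i).cast_nonneg (α := ℝ)
  have hy := (s.2 i).cast_nonneg (α := ℝ)
  have h3 : Real.exp (a * s.1 i) ≤ Real.exp (population s) := Real.exp_le_exp.2 (by nlinarith)
  have h4 : Real.exp (d * s.2 i) ≤ Real.exp (population s) := Real.exp_le_exp.2 (by nlinarith)
  simp only [expPair, Nat.cast_zero, mul_zero, zero_add, add_zero] at h1
  linarith

end ShiftMinExpPair

/-! ### Consequences of the choice of parameters. -/

namespace Model

variable (M : Model m) {ε β : ℝ} {α : Fin m → ℝ}

/-- If `α i` were 0, then `c0` would vanish and the bound on `β` would force `β ≤ 0`. -/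
lemma alpha_pos (hα : M.PerturbedFeasible ε α) (hβ : 0 < β)
    (hβ' : M.BetaBound ε β α) (i : Fin m) : 0 < α i := by
  refine (hα.2 i).1.lt_of_ne fun h => ?_
  have := hβ'.1 i
  simp only [c0, ← h] at this
  simp at this
  linarith

lemma c0_pos (hε : 0 < ε) (hα : M.PerturbedFeasible ε α) (hβ : 0 < β)
    (hβ' : M.BetaBound ε β α) (i : Fin m) : 0 < M.c0 ε α i := by
  have h1 := M.alpha_pos hα hβ hβ' i
  have h2 := M.req_pos i
  have h3 := M.rho_pos i
  unfold c0
  positivity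

lemma c1_pos (hε : 0 < ε) {i : Fin m} (hi : α i < 1) : 0 < M.c1 ε α i := by
  have h1 := sub_pos.2 hi
  have h2 := M.req_pos i
  have h3 := M.rho_pos i
  unfold c1
  positivity

lemma beta_mul_req_div_c0_le (hε : 0 < ε) (hα : M.PerturbedFeasible ε α) (hβ : 0 < β)
    (hβ' : M.BetaBound ε β α) (i : Fin m) : β * M.req i / M.c0 ε α i ≤ ε := by
  have := hβ'.1 i
  rwa [← mul_div_assoc, le_div_iff₀ (M.req_pos i), ← div_le_iff₀ (M.c0_pos hε hα hβ hβ' i)] at this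

lemma beta_mul_req_div_c1_nonneg (hε : 0 < ε) (hα : M.PerturbedFeasible ε α) (hβ : 0 < β)
    (i : Fin m) : 0 ≤ β * M.req i / M.c1 ε α i := by
  have h1 := sub_nonneg.2 (hα.2 i).2
  have h2 := M.req_pos i
  have h3 := M.rho_pos i
  unfold c1
  positivity

lemma beta_mul_req_div_c1_le (hε : 0 < ε) (hα : M.PerturbedFeasible ε α)
    (hβ' : M.BetaBound ε β α) (i : Fin m) : β * M.req i / M.c1 ε α i ≤ ε := by
  rcases (hα.2 i).2.lt_or_eq with h | h
  · have := hβ'.2 i h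
    rwa [← mul_div_assoc, le_div_iff₀ (M.req_pos i), ← div_le_iff₀ (M.c1_pos hε h)] at this
  -- Here `c1` is 0 and the quotient takes the default value 0.
  · simp [c1, h, hε.le]

lemma rho_mul_alpha_mul (hε : 0 < ε) (hα : M.PerturbedFeasible ε α) (hβ : 0 < β)
    (hβ' : M.BetaBound ε β α) (i : Fin m) :
    M.rho i * α i * (β * M.req i / M.c0 ε α i) = β / (1 + 4 * ε) := by
  have h1 := (M.alpha_pos hα hβ hβ' i).ne'
  have h2 := (M.req_pos i).ne'
  have h3 := (M.rho_pos i).ne'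
  unfold c0
  field_simp

lemma rho_mul_one_sub_alpha_mul (hε : 0 < ε) {i : Fin m} (hi : α i < 1) :
    M.rho i * (1 - α i) * (β * M.req i / M.c1 ε α i) = β / (1 + 4 * ε) := by
  have h1 := (sub_pos.2 hi).ne'
  have h2 := (M.req_pos i).ne'
  have h3 := (M.rho_pos i).ne'
  unfold c1
  field_simp

lemma sum_c0_le (hε : 0 < ε) (hα : M.PerturbedFeasible ε α) : ∑ i, M.c0 ε α i ≤ M.cap := by
  have h := hα.1
  rw [le_div_iff₀ (by linarith), Finset.sum_mul] at h
  refine le_of_eq_of_le (Finset.sum_congr rfl fun i _ => ?_) h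
  unfold c0
  ring

open Classical in
lemma drift_penalty_le (hε : 0 < ε) (hε' : ε < 1 / 4) (hα : M.PerturbedFeasible ε α) (hβ : 4 ≤ β)
    (hβ' : M.BetaBound ε β α) (i : Fin m) {G : ℕ → ℕ → ℝ}
    (hG : G = expPair (β * M.req i / M.c0 ε α i) (β * M.req i / M.c1 ε α i)) (x y : ℕ) :
    M.lam i * ((if M.c1 ε α i = 0 ∨ β * M.req i / M.c0 ε α i *
          Real.exp (β * M.req i / M.c0 ε α i * x) ≤
        β * M.req i / M.c1 ε α i * Real.exp (β * M.req i / M.c1 ε α i * y)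
        then G (x + 1) y else G x (y + 1)) - G x y)
      + M.mu i * x * (G (x - 1) y - G x y) + M.mu i * y * (G x (y - 1) - G x y) ≤
    M.mu i * (2 * Real.exp (β * (1 - ε / 2)) - G x y) := by
  have hβ0 : 0 < β := by linarith
  have ha : 0 ≤ β * M.req i / M.c0 ε α i :=
    div_nonneg (mul_nonneg hβ0.le (M.req_pos i).le) (M.c0_pos hε hα hβ0 hβ' i).le
  have haε := M.beta_mul_req_div_c0_le hε hα hβ0 hβ' i
  have hab := M.rho_mul_alpha_mul hε hα hβ0 hβ' i
  rw [← M.mu_mul_rho i, hG]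
  rcases (hα.2 i).2.lt_or_eq with h | h
  · simp only [(M.c1_pos hε h).ne', false_or]
    exact drift_expPair_le hε hε' hβ (M.mu_pos i).le (M.rho_pos i).le (hα.2 i).1 h.le ha haε
      (M.beta_mul_req_div_c1_nonneg hε hα hβ0 i) (M.beta_mul_req_div_c1_le hε hα hβ' i) hab
      (M.rho_mul_one_sub_alpha_mul hε h) x y
  · have hc : M.c1 ε α i = 0 := by simp [c1, h]
    rw [h, mul_one] at hab
    simp only [hc, true_or, if_true, div_zero]
    exact drift_expPair_zero_le hε hε' hβ (M.mu_pos i).le (M.rho_pos i).le ha haε hab x y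

open Classical in
lemma drift_shiftMin_penalty_le (hε : 0 < ε) (hε' : ε < 1 / 4) (hα : M.PerturbedFeasible ε α)
    (hβ : 4 ≤ β) (hβ' : M.BetaBound ε β α) (i : Fin m) {c : ℝ} (hc : 0 ≤ c) {F : ℕ → ℕ → ℝ}
    (hF : F = shiftMin c (expPair (β * M.req i / M.c0 ε α i) (β * M.req i / M.c1 ε α i)))
    (s : State m) :
    M.lam i * ((if M.PenaltyAccepts β (M.c0 ε α) (M.c1 ε α) i s ∧ M.HasRoom i s
        then F (s.1 i + 1) (s.2 i) else F (s.1 i) (s.2 i + 1)) - F (s.1 i) (s.2 i))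
      + M.mu i * s.1 i * (F (s.1 i - 1) (s.2 i) - F (s.1 i) (s.2 i))
      + M.mu i * s.2 i * (F (s.1 i) (s.2 i - 1) - F (s.1 i) (s.2 i)) ≤
    M.mu i * (2 * Real.exp (β * (1 - ε / 2)) - F (s.1 i) (s.2 i))
      + M.lam i * (c * if M.HasRoom i s then 0 else 1) := by
  have hβ0 : 0 < β := by linarith
  have ha : 0 ≤ β * M.req i / M.c0 ε α i :=
    div_nonneg (mul_nonneg hβ0.le (M.req_pos i).le) (M.c0_pos hε hα hβ0 hβ' i).le
  have hd := M.beta_mul_req_div_c1_nonneg hε hα hβ0 i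
  rw [M.penaltyAccepts_iff, hF]
  refine drift_shiftMin_le (acc := fun x y => M.c1 ε α i = 0 ∨ β * M.req i / M.c0 ε α i *
          Real.exp (β * M.req i / M.c0 ε α i * x) ≤
        β * M.req i / M.c1 ε α i * Real.exp (β * M.req i / M.c1 ε α i * y)) hc (M.lam_pos i).le
    (M.mu_pos i).le (fun x y k h => h.imp_right fun h => ?_)
    (fun x y => by convert M.drift_penalty_le hε hε' hα hβ hβ' i rfl x y) _ _ _
  -- The test is monotone: moving customers from the first coordinate to the second lowers the left
  -- side and raises the right side.
  refine le_trans ?_ (h.trans ?_) <;> gcongr <;> exact Nat.le_add_right _ _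

end Model

/-! ### Estimates in expectation for the policy. -/

namespace IsMarkovChain

variable {M : Model m} {ε β : ℝ} {α : Fin m → ℝ} {y₀ : Fin m → ℕ} {Ω : Type*}
  {mΩ : MeasurableSpace Ω} {P : Measure Ω} [IsProbabilityMeasure P] {ℱ : Filtration ℝ≥0 mΩ}
  {X : ℝ≥0 → Ω → State m}

/-- When `α i < 1`, the initial exponent in system 1 is exactly `β / (1 + 4 ε)`, so the penalty
starts below its equilibrium level. -/
lemma expPair_initial_le (hε : 0 < ε) (hε' : ε < 1 / 4) (hα : M.PerturbedFeasible ε α)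
    (hβ : 0 ≤ β) (hy₀ : ∀ i, (y₀ i : ℝ) = (1 - α i) * M.rho i) (a : ℝ) (i : Fin m) :
    expPair a (β * M.req i / M.c1 ε α i) 0 (y₀ i) ≤ 2 * Real.exp (β * (1 - ε / 2)) := by
  have hL : 0 ≤ β * (1 - ε / 2) := mul_nonneg hβ (by linarith)
  have h : β * M.req i / M.c1 ε α i * y₀ i ≤ β * (1 - ε / 2) := by
    rcases (hα.2 i).2.lt_or_eq with h | h
    · have h1 := M.rho_mul_one_sub_alpha_mul (β := β) hε h
      rw [hy₀, mul_comm, mul_comm (1 - α i), h1, div_le_iff₀ (by linarith), mul_assoc]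
      exact le_mul_of_one_le_right hβ (by nlinarith)
    · simpa [Model.c1, h] using hL
  have h1 := Real.exp_le_exp.2 h
  have h2 := Real.one_le_exp hL
  unfold expPair
  simp only [Nat.cast_zero, mul_zero, Real.exp_zero]
  linarith

/-- At price 0 forced rejections cost nothing, so the bound needs no prior estimate of how often the
resource is full. Shifts only increase the first coordinate, hence the shifted minimum still
dominates the exponential of `x`. -/
lemma integral_exp_le (hε : 0 < ε) (hε' : ε < 1 / 4) (hα : M.PerturbedFeasible ε α)
    (hβ : 4 ≤ β) (hβ' : M.BetaBound ε β α) (hy₀ : ∀ i, (y₀ i : ℝ) = (1 - α i) * M.rho i)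
    (hX : IsMarkovChain (M.generator β (M.c0 ε α) (M.c1 ε α)) (0, y₀) P ℱ X) (i : Fin m) (t : ℝ≥0) :
    Integrable (fun ω => Real.exp (β * M.req i / M.c0 ε α i * (X t ω).1 i)) P ∧
      ∫ ω, Real.exp (β * M.req i / M.c0 ε α i * (X t ω).1 i) ∂P ≤
        2 * Real.exp (β * (1 - ε / 2)) := by
  classical
  have hβ0 : 0 < β := by linarith
  have ha : 0 ≤ β * M.req i / M.c0 ε α i :=
    div_nonneg (mul_nonneg hβ0.le (M.req_pos i).le) (M.c0_pos hε hα hβ0 hβ' i).le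
  have haε := M.beta_mul_req_div_c0_le hε hα hβ0 hβ' i
  have hd := M.beta_mul_req_div_c1_nonneg hε hα hβ0 i
  have hdε := M.beta_mul_req_div_c1_le hε hα hβ' i
  have hexp1 : (1 : ℝ) ≤ Real.exp 1 := Real.one_le_exp zero_le_one
  set F := shiftMin 0 (expPair (β * M.req i / M.c0 ε α i) (β * M.req i / M.c1 ε α i)) with hF
  have hFle : ∀ s : State m, |F (s.1 i) (s.2 i)| ≤ 2 * Real.exp 1 ^ population s :=
    abs_shiftMin_expPair_le le_rfl (haε.trans (by linarith)) (hdε.trans (by linarith)) i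
  have hexpF : ∀ s : State m, Real.exp (β * M.req i / M.c0 ε α i * s.1 i) ≤ F (s.1 i) (s.2 i) :=
    fun s => exp_le_shiftMin_expPair le_rfl ha _ _ _
  have hint := hX.integrable_comp (by linarith) hFle t
  have hint' : Integrable (fun ω => Real.exp (β * M.req i / M.c0 ε α i * (X t ω).1 i)) P :=
    hX.integrable_comp (f := fun s => Real.exp (β * M.req i / M.c0 ε α i * s.1 i))
      (by linarith) (fun s => by
        rw [abs_of_pos (Real.exp_pos _)]
        exact (hexpF s).trans ((le_abs_self _).trans (hFle s))) t
  refine ⟨hint', (integral_mono hint' hint fun ω => hexpF _).trans ?_⟩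
  have hgen : ∀ s, M.generator β (M.c0 ε α) (M.c1 ε α) (fun s => F (s.1 i) (s.2 i)) s ≤
      M.mu i * (2 * Real.exp (β * (1 - ε / 2)) - F (s.1 i) (s.2 i))
        + M.lam i * (0 * if M.HasRoom i s then 0 else 1) := fun s => by
    rw [M.generator_class β (M.c0 ε α) (M.c1 ε α) i F s]
    exact M.drift_shiftMin_penalty_le hε hε' hα hβ hβ' i le_rfl hF s
  have h := hX.integral_le_of_generator_le zero_le_two hexp1 hFle i le_rfl hgen
    (integral_noRoom_le_one i) t
  have h0 : F 0 (y₀ i) ≤ 2 * Real.exp (β * (1 - ε / 2)) := by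
    have h1 := shiftMin_le (c := 0)
      (G := expPair (β * M.req i / M.c0 ε α i) (β * M.req i / M.c1 ε α i))
      (x := 0) (y := y₀ i) (k := 0) rfl rfl
    rw [zero_mul, zero_add] at h1
    exact h1.trans (expPair_initial_le hε hε' hα hβ0.le hy₀ _ i)
  have h1 := mul_nonneg (sub_nonneg.2 h0) (Real.exp_pos (-(M.mu i * t))).le
  simp only [mul_zero, zero_mul, add_zero, Pi.zero_apply] at h
  linarith

open Classical in
-- Markov's inequality loses the factor `exp (ε - β)` against the moment `2 exp (β (1 - ε/2))`,
-- which gives `2 exp (-(ε/2) (β - 2))`, slightly better than what is claimed.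
lemma integral_noRoom_le (hε : 0 < ε) (hε' : ε < 1 / 4) (hα : M.PerturbedFeasible ε α)
    (hβ : 4 ≤ β) (hβ' : M.BetaBound ε β α) (hy₀ : ∀ i, (y₀ i : ℝ) = (1 - α i) * M.rho i)
    (hX : IsMarkovChain (M.generator β (M.c0 ε α) (M.c1 ε α)) (0, y₀) P ℱ X) (i : Fin m) (t : ℝ≥0) :
    ∫ ω, (if M.HasRoom i (X t ω) then (0 : ℝ) else 1) ∂P ≤
      2 * Real.exp (-(ε / 2 * (β - 4))) := by
  have hβ0 : 0 < β := by linarith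
  have hc := M.c0_pos hε hα hβ0 hβ'
  have hsum := M.sum_c0_le hε hα
  have hcap := M.cap_pos
  have hi : β * M.req i ≤ ε * M.cap := by
    have h1 := M.beta_mul_req_div_c0_le hε hα hβ0 hβ' i
    rw [div_le_iff₀ (hc i)] at h1
    refine h1.trans (mul_le_mul_of_nonneg_left (le_trans ?_ hsum) hε.le)
    exact Finset.single_le_sum (fun j _ => (hc j).le) (Finset.mem_univ i)
  set W := 2 * Real.exp (β * (1 - ε / 2)) with hW
  have hW1 : 1 ≤ W := by
    have := Real.one_le_exp (mul_nonneg hβ0.le (by linarith : 0 ≤ 1 - ε / 2))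
    linarith
  have hexp := fun j => integral_exp_le hε hε' hα hβ hβ' hy₀ hX j t
  have hsum' : ∑ j, M.c0 ε α j / M.cap ≤ 1 := by
    rw [← Finset.sum_div, div_le_one hcap]; exact hsum
  have hS : Integrable (fun ω => ∑ j, M.c0 ε α j / M.cap *
      Real.exp (β * M.req j / M.c0 ε α j * (X t ω).1 j)) P :=
    integrable_finsetSum _ fun j _ => (hexp j).1.const_mul _
  have hmono := integral_mono (μ := P)
    (Integrable.of_bound
      (hX.measurable_comp (fun s => if M.HasRoom i s then (0 : ℝ) else 1) t).aestronglyMeasurable 1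
      (Eventually.of_forall fun ω => by split_ifs <;> simp))
    ((hS.add (integrable_const (1 - ∑ j, M.c0 ε α j / M.cap))).const_mul (Real.exp (ε - β)))
    fun ω => M.noRoom_le hc hβ0.le hsum i hi (X t ω)
  refine hmono.trans ?_
  simp only [Pi.add_apply]
  rw [integral_const_mul, integral_add hS (integrable_const _), integral_const, probReal_univ,
    one_smul, integral_finsetSum _ fun j _ => (hexp j).1.const_mul _]
  have h1 : ∑ j, ∫ ω, M.c0 ε α j / M.cap *
      Real.exp (β * M.req j / M.c0 ε α j * (X t ω).1 j) ∂P ≤ (∑ j, M.c0 ε α j / M.cap) * W := by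
    rw [Finset.sum_mul]
    refine Finset.sum_le_sum fun j _ => ?_
    rw [integral_const_mul]
    exact mul_le_mul_of_nonneg_left (hexp j).2 (div_nonneg (hc j).le hcap.le)
  have h2 : 1 - ∑ j, M.c0 ε α j / M.cap ≤ (1 - ∑ j, M.c0 ε α j / M.cap) * W :=
    le_mul_of_one_le_right (by linarith) hW1
  calc _ ≤ Real.exp (ε - β) * W :=
        mul_le_mul_of_nonneg_left (by linarith) (Real.exp_pos _).le
    _ = 2 * Real.exp (ε - β + β * (1 - ε / 2)) := by rw [hW, Real.exp_add]; ring
    _ ≤ _ := by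
        gcongr
        linarith

lemma cast_le_pow_population (n : ℕ) (s : State m) (h : n ≤ population s) :
    (n : ℝ) ≤ Real.exp 1 ^ population s := by
  rw [← Real.exp_nat_mul, mul_one]
  have h1 := Real.add_one_le_exp (population s : ℝ)
  have h2 : (n : ℝ) ≤ population s := by exact_mod_cast h
  linarith

lemma integrable_fst {c₀ c₁ : Fin m → ℝ} {s₀ : State m}
    (hX : IsMarkovChain (M.generator β c₀ c₁) s₀ P ℱ X) (i : Fin m) (t : ℝ≥0) :
    Integrable (fun ω => ((X t ω).1 i : ℝ)) P :=
  hX.integrable_comp (f := fun s => (s.1 i : ℝ)) (C := 1) (Real.exp_pos 1).le (fun s => by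
    rw [Nat.abs_cast, one_mul]
    exact cast_le_pow_population _ _ ((Nat.le_add_right _ _).trans (le_population s i))) t

lemma cast_mul_cast_sub_one (n : ℕ) : (n : ℝ) * ((n - 1 : ℕ) : ℝ) = n * (n - 1) := by
  obtain _ | k := n
  · simp
  · simp

/-- The lower bound for a class that is accepted whenever there is room. -/
lemma integral_fst_ge_of_eq_one {c₀ c₁ : Fin m → ℝ}
    (hX : IsMarkovChain (M.generator β c₀ c₁) (0, y₀) P ℱ X) {i : Fin m} (hi : c₁ i = 0) {δ : ℝ}
    (hδ : ∀ u, ∫ ω, (open Classical in if M.HasRoom i (X u ω) then (0 : ℝ) else 1) ∂P ≤ δ)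
    (t : ℝ≥0) :
    M.rho i * (1 - δ) * (1 - Real.exp (-(M.mu i * t))) ≤ ∫ ω, ((X t ω).1 i : ℝ) ∂P := by
  classical
  -- The penalty test always passes, so `x` is an infinite-server queue that loses arrivals only
  -- when there is no room.
  have hgen : ∀ s, M.generator β c₀ c₁ (fun s => -(s.1 i : ℝ)) s ≤
      M.mu i * (-M.rho i - -(s.1 i : ℝ)) + M.lam i * (1 * if M.HasRoom i s then 0 else 1) := by
    intro s
    rw [M.generator_class β c₀ c₁ i (fun x _ => -(x : ℝ)) s]
    have h1 := congrArg (M.mu i * ·) (cast_mul_cast_sub_one (s.1 i))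
    have h2 := M.mu_mul_rho i
    have hacc : M.PenaltyAccepts β c₀ c₁ i s := Or.inl hi
    simp only [hacc, true_and]
    split_ifs <;> push_cast <;> linarith
  have h := hX.integral_le_of_generator_le (C := 1) (K := Real.exp 1) zero_le_one
    (Real.one_le_exp zero_le_one) (fun s => by
      rw [abs_neg, Nat.abs_cast, one_mul]
      exact cast_le_pow_population _ _ ((Nat.le_add_right _ _).trans (le_population s i)))
    i zero_le_one hgen hδ t
  rw [integral_neg] at h
  simp only [Pi.zero_apply, Nat.cast_zero, neg_zero] at h
  linarith

/-- The lower bound for a class whose target acceptance probability is less than one. -/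
lemma integral_fst_ge_of_lt_one (hε : 0 < ε) (hε' : ε < 1 / 4) (hα : M.PerturbedFeasible ε α)
    (hβ : 4 ≤ β) (hβ' : M.BetaBound ε β α) (hy₀ : ∀ i, (y₀ i : ℝ) = (1 - α i) * M.rho i)
    (hX : IsMarkovChain (M.generator β (M.c0 ε α) (M.c1 ε α)) (0, y₀) P ℱ X) {i : Fin m}
    (hi : α i < 1) {δ : ℝ}
    (hδ : ∀ u, ∫ ω, (open Classical in if M.HasRoom i (X u ω) then (0 : ℝ) else 1) ∂P ≤ δ)
    (t : ℝ≥0) :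
    M.rho i - (1 + 4 * ε) * ((1 - α i) * M.rho i) * (Real.log 2 / β + 1 - ε / 2)
        - M.rho i * δ + M.rho i * (δ - α i) * Real.exp (-(M.mu i * t)) ≤
      ∫ ω, ((X t ω).1 i : ℝ) ∂P := by
  classical
  have hβ0 : 0 < β := by linarith
  set a := β * M.req i / M.c0 ε α i with ha_def
  set d := β * M.req i / M.c1 ε α i with hd_def
  have ha : 0 ≤ a := div_nonneg (mul_nonneg hβ0.le (M.req_pos i).le) (M.c0_pos hε hα hβ0 hβ' i).le
  have haε : a ≤ ε := M.beta_mul_req_div_c0_le hε hα hβ0 hβ' i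
  have hd : 0 < d := div_pos (mul_pos hβ0 (M.req_pos i)) (M.c1_pos hε hi)
  have hdε : d ≤ ε := M.beta_mul_req_div_c1_le hε hα hβ' i
  set W := 2 * Real.exp (β * (1 - ε / 2)) with hW
  have hW0 : 0 < W := by positivity
  set c := d * W with hc
  have hc0 : 0 < c := mul_pos hd hW0
  set F := shiftMin c (expPair a d) with hF
  -- Up to a constant, `c⁻¹ * F` dominates `y`, so `f` dominates `y - (x + y) = -x`. Dividing by `c`
  -- also makes a forced rejection cost one unit, however large `W` is.
  set f : State m → ℝ := fun s => c⁻¹ * F (s.1 i) (s.2 i) - (s.1 i + s.2 i) with hf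
  have hfle : ∀ s, |f s| ≤ (c⁻¹ * 2 + 1) * Real.exp 1 ^ population s := fun s => by
    have h1 := abs_shiftMin_expPair_le hc0.le (by linarith : a ≤ 1) (by linarith : d ≤ 1) i s
    have h2 := cast_le_pow_population _ _ (le_population s i)
    have h3 := abs_sub (c⁻¹ * F (s.1 i) (s.2 i)) (s.1 i + s.2 i)
    have h4 := mul_le_mul_of_nonneg_left h1 (inv_pos.2 hc0).le
    have h5 : |(s.1 i + s.2 i : ℝ)| = s.1 i + s.2 i := abs_of_nonneg (by positivity)
    rw [abs_mul, abs_of_pos (inv_pos.2 hc0), h5] at h3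
    push_cast at h2
    simp only [hf]
    linarith
  have hgen : ∀ s, M.generator β (M.c0 ε α) (M.c1 ε α) f s ≤
      M.mu i * (c⁻¹ * W - M.rho i - f s) + M.lam i * (1 * if M.HasRoom i s then 0 else 1) := by
    intro s
    rw [hf, M.generator_class β (M.c0 ε α) (M.c1 ε α) i
      (fun x y => c⁻¹ * F x y - ((x : ℝ) + y)) s]
    have h0 := mul_le_mul_of_nonneg_left
      (M.drift_shiftMin_penalty_le hε hε' hα hβ hβ' i hc0.le hF s) (inv_pos.2 hc0).le
    have h1 := congrArg (M.mu i * ·) (cast_mul_cast_sub_one (s.1 i))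
    have h2 := congrArg (M.mu i * ·) (cast_mul_cast_sub_one (s.2 i))
    have h3 := M.mu_mul_rho i
    have h4 : c⁻¹ * (M.lam i * (c * if M.HasRoom i s then 0 else 1)) =
        M.lam i * (1 * if M.HasRoom i s then 0 else 1) := by field_simp
    rw [mul_add c⁻¹ (M.mu i * _) (M.lam i * _), h4] at h0
    generalize (M.lam i * (1 * if M.HasRoom i s then (0 : ℝ) else 1)) = v at h0 ⊢
    split_ifs at h0 ⊢ <;> push_cast at h1 h2 ⊢ <;> linarith
  have hmain := hX.integral_le_of_generator_le (by positivity) (Real.one_le_exp zero_le_one) hfle i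
    zero_le_one hgen hδ t
  -- This exceeds the level `c⁻¹ * W - ρ_i` by `α_i ρ_i`, the coefficient of the transient term.
  have hinit : f (0, y₀) ≤ c⁻¹ * W - (1 - α i) * M.rho i := by
    have h1 := shiftMin_le (c := c) (G := expPair a d) (x := 0) (y := y₀ i) (k := 0) rfl rfl
    rw [Nat.cast_zero, mul_zero, zero_add] at h1
    have h2 := mul_le_mul_of_nonneg_left
      (h1.trans (expPair_initial_le hε hε' hα hβ0.le hy₀ a i)) (inv_pos.2 hc0).le
    simp only [hf, Pi.zero_apply, Nat.cast_zero, zero_add, hy₀]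
    linarith
  have hx : ∀ s : State m, -(s.1 i : ℝ) ≤ c⁻¹ * (W * Real.log W - W) + f s := fun s => by
    have h1 := mul_le_mul_of_nonneg_left (mul_le_shiftMin_expPair hW0 a d (s.1 i) (s.2 i))
      (inv_pos.2 hc0).le
    rw [← hc, ← mul_assoc, inv_mul_cancel₀ hc0.ne', one_mul] at h1
    simp only [hf]
    linarith
  have hfi := hX.integrable_comp (Real.exp_pos 1).le hfle t
  have hmono := integral_mono (μ := P) (hX.integrable_fst i t).neg
    ((integrable_const (c⁻¹ * (W * Real.log W - W))).add hfi) fun ω => hx (X t ω)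
  simp only [Pi.add_apply, Pi.neg_apply] at hmono
  rw [integral_neg, integral_add (integrable_const _) hfi, integral_const, probReal_univ,
    one_smul] at hmono
  -- The terms in `c⁻¹ * W` cancel between the tangent bound and the equilibrium level. What remains
  -- is `log W / d`, which is `(ζ + 1) (1 - α_i) ρ_i`.
  have hlog : c⁻¹ * (W * Real.log W) =
      (1 + 4 * ε) * ((1 - α i) * M.rho i) * (Real.log 2 / β + 1 - ε / 2) := by
    have h1 : Real.log W = Real.log 2 + β * (1 - ε / 2) := by
      rw [hW, Real.log_mul two_ne_zero (Real.exp_pos _).ne', Real.log_exp]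
    have h2 : c⁻¹ * (W * Real.log W) = d⁻¹ * Real.log W := by
      rw [hc, mul_inv]
      field_simp
    have h3 : d⁻¹ = (1 + 4 * ε) * ((1 - α i) * M.rho i) / β := by
      have := (M.req_pos i).ne'
      rw [hd_def, inv_div, Model.c1]
      field_simp
    rw [h2, h1, h3]
    field_simp
    ring
  have hE := mul_le_mul_of_nonneg_right hinit (Real.exp_pos (-(M.mu i * t))).le
  linarith

/-- The lower bound on the mean number of class `i` requests in service. -/
lemma integral_fst_ge (hε : 0 < ε) (hε' : ε < 1 / 4) (hα : M.PerturbedFeasible ε α)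
    (hβ : 0 < β) (hβ' : M.BetaBound ε β α) (hy₀ : ∀ i, (y₀ i : ℝ) = (1 - α i) * M.rho i)
    (hX : IsMarkovChain (M.generator β (M.c0 ε α) (M.c1 ε α)) (0, y₀) P ℱ X) (i : Fin m) (t : ℝ≥0) :
    α i * M.rho i * (1 - Real.exp (-(M.mu i * t)))
        - ((Real.log 2 / β + 1 - ε / 2) * (1 + 4 * ε) - 1) * ((1 - α i) * M.rho i)
        - 2 * Real.exp (-(ε / 2 * (β - 4))) * (M.rho i * (1 - Real.exp (-(M.mu i * t)))) ≤
      ∫ ω, ((X t ω).1 i : ℝ) ∂P := by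
  rcases le_or_gt 4 β with h4 | h4
  · have hδ := integral_noRoom_le hε hε' hα h4 hβ' hy₀ hX i
    rcases (hα.2 i).2.lt_or_eq with h | h
    · have := integral_fst_ge_of_lt_one hε hε' hα h4 hβ' hy₀ hX h hδ t
      linarith
    · have := hX.integral_fst_ge_of_eq_one (i := i) (by simp [Model.c1, h]) hδ t
      rw [h]
      linarith
  -- For `β < 4` the last subtracted term alone is at least twice `ρ_i (1 - exp (-μ_i t))`, and `ζ ≥
  -- 0`, so the left-hand side is at most 0.
  · have hρ := M.rho_pos i
    have hE : 0 ≤ 1 - Real.exp (-(M.mu i * t)) := by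
      rw [sub_nonneg, Real.exp_le_one_iff]
      have := mul_nonneg (M.mu_pos i).le t.coe_nonneg
      linarith
    have hδ : 1 ≤ Real.exp (-(ε / 2 * (β - 4))) := Real.one_le_exp (by nlinarith)
    have hζ : 0 ≤ (Real.log 2 / β + 1 - ε / 2) * (1 + 4 * ε) - 1 := by
      have : 0 ≤ Real.log 2 / β := div_nonneg (Real.log_nonneg one_le_two) hβ.le
      nlinarith
    have h1 := mul_nonneg hζ (mul_nonneg (sub_nonneg.2 (hα.2 i).2) hρ.le)
    have h2 := mul_nonneg hρ.le hE
    have h3 := mul_le_mul_of_nonneg_right hδ h2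
    have h4 := mul_le_mul_of_nonneg_right (hα.2 i).2 h2
    have h5 : 0 ≤ ∫ ω, ((X t ω).1 i : ℝ) ∂P := integral_nonneg fun ω => Nat.cast_nonneg _
    linarith

end IsMarkovChain

end LossNetwork

/-! ### Summation over the classes. -/

theorem theorem2 {m : ℕ} (M : LossNetwork.Model m) (ε β : ℝ) (α : Fin m → ℝ) (y₀ : Fin m → ℕ)
    (hε : 0 < ε) (hε' : ε < 1 / 4)
    (hα : M.PerturbedOptimal ε α)
    (hβ : 0 < β) (hβ' : M.BetaBound ε β α)
    (hy₀ : ∀ i, (y₀ i : ℝ) = (1 - α i) * M.rho i)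
    {Ω : Type*} {mΩ : MeasurableSpace Ω} (P : Measure Ω) [IsProbabilityMeasure P]
    (ℱ : Filtration ℝ≥0 mΩ) (X : ℝ≥0 → Ω → LossNetwork.State m)
    (hX : LossNetwork.IsMarkovChain (M.generator β (M.c0 ε α) (M.c1 ε α)) (0, y₀) P ℱ X)
    (ζ : ℝ) (hζ : ζ = (Real.log 2 / β + 1 - ε / 2) * (1 + 4 * ε) - 1) (t : ℝ≥0) :
    Integrable (fun ω => M.rewardRate (X t ω)) P ∧
      max (∑ i, α i * M.r i * M.rho i * (1 - Real.exp (-(M.mu i * t)))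
            - ζ * ∑ i, (1 - α i) * M.r i * M.rho i
            - 2 * Real.exp (-(ε / 2 * (β - 4))) *
                ∑ i, M.r i * M.rho i * (1 - Real.exp (-(M.mu i * t)))) 0
        ≤ ∫ ω, M.rewardRate (X t ω) ∂P := by
  have hint : ∀ i, Integrable (fun ω => M.r i * ((X t ω).1 i : ℝ)) P := fun i =>
    (hX.integrable_fst i t).const_mul _
  refine ⟨integrable_finsetSum _ fun i _ => hint i, max_le ?_ ?_⟩
  · unfold LossNetwork.Model.rewardRate
    rw [integral_finsetSum _ fun i _ => hint i, Finset.mul_sum, Finset.mul_sum,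
      ← Finset.sum_sub_distrib, ← Finset.sum_sub_distrib]
    refine Finset.sum_le_sum fun i _ => ?_
    rw [integral_const_mul, hζ]
    have := mul_le_mul_of_nonneg_left
      (LossNetwork.IsMarkovChain.integral_fst_ge hε hε' hα.1 hβ hβ' hy₀ hX i t) (M.r_nonneg i)
    linarith
  · exact integral_nonneg fun ω =>
      Finset.sum_nonneg fun i _ => mul_nonneg (M.r_nonneg i) (Nat.cast_nonneg _)
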